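/- A digraph $G=(V,E)$ consists of a finite set $V$ and a set $E\subset V\times V$ of edges $v\to w$ without self-loops; write $v\,\overrightarrow{=}\,w$ if $v=w$ or $v\to w$. A digraph map sends each edge $v\to w$ to vertices with $f(v)\,\overrightarrow{=}\,f(w)$. A line digraph $I_n$ ($n\ge 0$) has vertices $0,\dots,n$, exactly one of the edges $i\to i+1$, $i+1\to i$ for each $0\le i<n$, and no other edges. A path-map in $G$ from $\phi(0)$ to $\phi(n)$ is a digraph map $\phi\colon I_n\to G$, and $G$ is connected if any two vertices are joined by a path-map. Let $G^*$ be a digraph $G$ with a base vertex $*$. A loop on $G^*$ is a path-map $\phi\colon I_n\to G$ with $\phi(0)=\phi(n)=*$. A shrinking map $h\colon I_n\to I_m$ is a monotone (non-decreasing) digraph map with $h(0)=0$, $h(n)=m$. There is a one-step direct (respectively inverse) $C$-homotopy from $\phi\colon I_n\to G$ to $\psi\colon I_m\to G$ if for some shrinking map $h\colon I_n\to I_m$ the map given by $\phi$ on $I_n$ and by $\psi$ on $I_m$ is a digraph map to $G$ from the disjoint union $I_n\sqcup I_m$ with the additional edges $i\to h(i)$ (respectively $h(i)\to i$), $i\in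 I_n$. Two loops are $C$-homotopic if they are joined by a finite sequence of loops on $G^*$ in which, for any two consecutive loops, there is a one-step direct or inverse $C$-homotopy from one of them to the other. The fundamental group $\pi_1(G^*)$ is the set of $C$-homotopy classes of loops, with product induced by concatenation. For $p\ge 0$ let $\mathcal R_p$ be the free $\mathbb Z$-module on the sequences $e_{i_0\dots i_p}$ of vertices with $i_k\ne i_{k+1}$ for all $k$; set $e_{i_0\dots i_p}=0$ for all other sequences, and let $\partial e_{i_0\dots i_p}=\sum_{q=0}^p(-1)^q e_{i_0\dots\widehat{i_q}\dots i_p}$ for $p\ge 1$. Let $\mathcal A_p\subset\mathcal R_p$ be the span of the $e_{i_0\dots i_p}$ with $i_k\to i_{k+1}$ for all $k$, let $\Omega_p=\{v\in\mathcal A_p:\partial v\in\mathcal A_{p-1}\}$ for $p\ge 1$, and let $H_1(G,\mathbb Z)=\ker(\partial|_{\Omega_1})/\partial(\Omega_2)$ be the first path homology group of $G$. **Theorem.** For any based connected digraph $G^*$ there is an isomorphism of groups $$\pi_1(G^*)\,/\,[\pi_1(G^*),\pi_1(G^*)]\;\cong\; H_1(G,\mathbb Z),$$ where $[\pi_1(G^*),\pi_1(G^*)]$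 is the commutator subgroup. -/

import Mathlib

/-! Homotopy and path homology of digraphs. A digraph is Mathlib's `Digraph V`, used here under the
hypothesis that it has no self-loops. -/

namespace DigraphHomotopy

universe u v

section DigraphMaps

variable {V : Type u} {W : Type v}

/-- `v = w` or `v → w`. -/
def EqOrAdj (G : Digraph V) (v w : V) : Prop := v = w ∨ G.Adj v w

/-- A digraph map sends every edge to an edge or to a single vertex. -/
def IsDigraphMap (G : Digraph V) (H : Digraph W) (f : V → W) : Prop :=
  ∀ v w, G.Adj v w → EqOrAdj H (f v) (f w)

/-- The cylinder of `f`: the disjoint union of `G` and `H` together with all edges `x → f x`. -/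
def cylinder (G : Digraph V) (H : Digraph W) (f : V → W) : Digraph (V ⊕ W) where
  Adj
    | .inl x, .inl y => G.Adj x y
    | .inr x, .inr y => H.Adj x y
    | .inl x, .inr y => y = f x
    | .inr _, .inl _ => False

/-- The inverse cylinder of `f`: the disjoint union of `G` and `H` together with all edges
`f x → x`. -/
def invCylinder (G : Digraph V) (H : Digraph W) (f : V → W) : Digraph (V ⊕ W) where
  Adj
    | .inl x, .inl y => G.Adj x y
    | .inr x, .inr y => H.Adj x y
    | .inl _, .inr _ => False
    | .inr y, .inl x => y = f x

end DigraphMaps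

/-- The line digraph on `{0, …, n}` given by `o`: for each `k < n` it has exactly one of the edges
`k → k + 1` (if `o k = true`) and `k + 1 → k` (if `o k = false`), and no other edges. -/
def lineDigraph {n : ℕ} (o : Fin n → Bool) : Digraph (Fin (n + 1)) where
  Adj i j := ∃ k : Fin n, (o k = true ∧ i = k.castSucc ∧ j = k.succ) ∨
    (o k = false ∧ i = k.succ ∧ j = k.castSucc)

/-- A shrinking map between line digraphs. -/
structure IsShrinking {n m : ℕ} (o : Fin n → Bool) (o' : Fin m → Bool)
    (h : Fin (n + 1) → Fin (m + 1)) : Prop where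
  isDigraphMap : IsDigraphMap (lineDigraph o) (lineDigraph o') h
  map_zero : h 0 = 0
  map_last : h (Fin.last n) = Fin.last m
  monotone : Monotone h

/-- A path-map in `G`: a digraph map from a line digraph to `G`. -/
structure PathMap {V : Type u} (G : Digraph V) where
  /-- the number `n` of edges of the line digraph -/
  length : ℕ
  /-- the directions of the edges of the line digraph -/
  orient : Fin length → Bool
  /-- the map on vertices -/
  toFun : Fin (length + 1) → V
  isDigraphMap : IsDigraphMap (lineDigraph orient) G toFun

variable {V : Type u} {G : Digraph V} {b : V}

namespace PathMap

/-- The initial vertex of a path-map. -/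
def source (φ : PathMap G) : V := φ.toFun 0

/-- The final vertex of a path-map. -/
def target (φ : PathMap G) : V := φ.toFun (Fin.last φ.length)

end PathMap

/-- A digraph is connected if any two vertices are joined by a path-map. -/
def Connected (G : Digraph V) : Prop :=
  ∀ v w : V, ∃ φ : PathMap G, φ.source = v ∧ φ.target = w

/-- There is a one-step direct `C`-homotopy from `φ` to `ψ`. -/
def OneStepDirect (φ ψ : PathMap G) : Prop :=
  ∃ h : Fin (φ.length + 1) → Fin (ψ.length + 1), IsShrinking φ.orient ψ.orient h ∧
    IsDigraphMap (cylinder (lineDigraph φ.orient) (lineDigraph ψ.orient) h) G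
      (Sum.elim φ.toFun ψ.toFun)

/-- There is a one-step inverse `C`-homotopy from `φ` to `ψ`. -/
def OneStepInverse (φ ψ : PathMap G) : Prop :=
  ∃ h : Fin (φ.length + 1) → Fin (ψ.length + 1), IsShrinking φ.orient ψ.orient h ∧
    IsDigraphMap (invCylinder (lineDigraph φ.orient) (lineDigraph ψ.orient) h) G
      (Sum.elim φ.toFun ψ.toFun)

/-- A loop of the based digraph `(G, b)`. -/
structure Loop (G : Digraph V) (b : V) extends PathMap G where
  source_eq : toPathMap.source = b
  target_eq : toPathMap.target = b

/-- The loop-digraph: its vertices are the loops, and `φ → ψ` if `φ ≠ ψ` and there is a one-step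
direct `C`-homotopy from `φ` to `ψ` or a one-step inverse `C`-homotopy from `ψ` to `φ`. -/
def loopDigraph (G : Digraph V) (b : V) : Digraph (Loop G b) where
  Adj φ ψ := φ ≠ ψ ∧
    (OneStepDirect φ.toPathMap ψ.toPathMap ∨ OneStepInverse ψ.toPathMap φ.toPathMap)

/-- Two loops are `C`-homotopic if they are joined by a finite sequence of loops in which any two
consecutive loops are joined by an edge of the loop-digraph, in one direction or the other. -/
def loopSetoid (G : Digraph V) (b : V) : Setoid (Loop G b) :=
  Relation.EqvGen.setoid (loopDigraph G b).Adj

/-- The set `π₁(G, b)` of `C`-homotopy classes of loops. -/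
def FundamentalGroup (G : Digraph V) (b : V) : Type u := Quotient (loopSetoid G b)

/-! ### Local form of digraph maps on a line digraph, and access by natural numbers -/

theorem isDigraphMap_line_iff {n : ℕ} (o : Fin n → Bool) (f : Fin (n + 1) → V) :
    IsDigraphMap (lineDigraph o) G f ↔ ∀ k : Fin n,
      (o k = true → EqOrAdj G (f k.castSucc) (f k.succ)) ∧
      (o k = false → EqOrAdj G (f k.succ) (f k.castSucc)) := by
  constructor
  · intro H k
    exact ⟨fun h => H _ _ ⟨k, Or.inl ⟨h, rfl, rfl⟩⟩, fun h => H _ _ ⟨k, Or.inr ⟨h, rfl, rfl⟩⟩⟩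
  · rintro H v w ⟨k, ⟨h, rfl, rfl⟩ | ⟨h, rfl, rfl⟩⟩
    · exact (H k).1 h
    · exact (H k).2 h

namespace PathMap

/-- The `i`-th vertex, constant after the end. -/
def vert (φ : PathMap G) (i : ℕ) : V := φ.toFun ⟨min i φ.length, by omega⟩

/-- The direction of the `i`-th edge, `true` after the end. -/
def dir (φ : PathMap G) (i : ℕ) : Bool := if h : i < φ.length then φ.orient ⟨i, h⟩ else true

theorem vert_val (φ : PathMap G) (i : Fin (φ.length + 1)) : φ.vert i = φ.toFun i := by
  unfold vert
  congr 1
  ext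
  simp
  omega

theorem dir_val (φ : PathMap G) (i : Fin φ.length) : φ.dir i = φ.orient i := by
  simp [dir]

theorem vert_zero (φ : PathMap G) : φ.vert 0 = φ.source := by
  exact φ.vert_val 0

theorem vert_of_le (φ : PathMap G) {i : ℕ} (hi : φ.length ≤ i) : φ.vert i = φ.target := by
  unfold vert target
  congr 1
  ext
  simpa using hi

theorem step (φ : PathMap G) (i : ℕ) :
    (φ.dir i = true → EqOrAdj G (φ.vert i) (φ.vert (i + 1))) ∧
    (φ.dir i = false → EqOrAdj G (φ.vert (i + 1)) (φ.vert i)) := by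
  by_cases hi : i < φ.length
  · have := (isDigraphMap_line_iff _ _).1 φ.isDigraphMap ⟨i, hi⟩
    rw [← dir_val, ← vert_val, ← vert_val] at this
    simpa using this
  · have h1 : φ.vert i = φ.vert (i + 1) := by
      rw [vert_of_le _ (by omega), vert_of_le _ (by omega)]
    exact ⟨fun _ => Or.inl h1, fun _ => Or.inl h1.symm⟩

/-- The path-map with prescribed vertices and directions. -/
def ofNat (n : ℕ) (f : ℕ → V) (o : ℕ → Bool)
    (H : ∀ i < n, (o i = true → EqOrAdj G (f i) (f (i + 1))) ∧
      (o i = false → EqOrAdj G (f (i + 1)) (f i))) : PathMap G where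
  length := n
  orient k := o k
  toFun i := f i
  isDigraphMap := (isDigraphMap_line_iff _ _).2 fun k => by simpa using H k k.2

theorem vert_ofNat {n : ℕ} {f : ℕ → V} {o : ℕ → Bool} {H} {i : ℕ} (hi : i ≤ n) :
    (ofNat (G := G) n f o H).vert i = f i := by
  simp [vert, ofNat, hi]

theorem dir_ofNat {n : ℕ} {f : ℕ → V} {o : ℕ → Bool} {H} {i : ℕ} (hi : i < n) :
    (ofNat (G := G) n f o H).dir i = o i := by
  simp [dir, ofNat, hi]

/-! ### Concatenation and inverse of path-maps -/

/-- The vertices of the concatenation of two path-maps. -/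
def concatFun (φ ψ : PathMap G) (i : Fin (φ.length + ψ.length + 1)) : V :=
  if h : (i : ℕ) ≤ φ.length then φ.toFun ⟨i, by omega⟩ else ψ.toFun ⟨i - φ.length, by omega⟩

theorem concatFun_eq (φ ψ : PathMap G) (i : Fin (φ.length + ψ.length + 1)) :
    concatFun φ ψ i = if (i : ℕ) ≤ φ.length then φ.vert i else ψ.vert (i - φ.length) := by
  unfold concatFun
  split_ifs with h
  · rw [← vert_val]
  · rw [← vert_val]

theorem append_eq (φ ψ : PathMap G) (k : Fin (φ.length + ψ.length)) :
    Fin.append φ.orient ψ.orient k =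
      if (k : ℕ) < φ.length then φ.dir k else ψ.dir (k - φ.length) := by
  refine Fin.addCases (fun i => ?_) (fun i => ?_) k
  · simp [← dir_val]
  · simp [← dir_val]

/-- The concatenation `φ ∨ ψ`. -/
def concat (φ ψ : PathMap G) (h : φ.target = ψ.source) : PathMap G where
  length := φ.length + ψ.length
  orient := Fin.append φ.orient ψ.orient
  toFun := concatFun φ ψ
  isDigraphMap := by
    rw [isDigraphMap_line_iff]
    intro k
    rw [append_eq, concatFun_eq, concatFun_eq]
    simp only [Fin.val_castSucc, Fin.val_succ]
    rcases lt_trichotomy (k : ℕ) φ.length with hk | hk | hk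
    · rw [if_pos hk, if_pos hk.le, if_pos (by omega)]
      exact φ.step k
    · rw [if_neg (by omega), if_pos hk.le, if_neg (by omega), vert_of_le _ hk.ge, h, ← vert_zero]
      have := ψ.step 0
      simpa [hk] using this
    · rw [if_neg (by omega), if_neg (by omega), if_neg (by omega)]
      have := ψ.step (k - φ.length)
      rwa [show (k : ℕ) - φ.length + 1 = k + 1 - φ.length by omega] at this

/-- The inverse path-map, on the reversed line digraph. -/
def reverse (φ : PathMap G) : PathMap G where
  length := φ.length
  orient k := !φ.orient k.rev
  toFun i := φ.toFun i.rev
  isDigraphMap := by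
    rw [isDigraphMap_line_iff]
    intro k
    have := (isDigraphMap_line_iff _ _).1 φ.isDigraphMap k.rev
    rw [Fin.rev_castSucc, Fin.rev_succ]
    simpa [and_comm] using this

theorem length_concat (φ ψ : PathMap G) (h) :
    (concat φ ψ h).length = φ.length + ψ.length := rfl

theorem length_reverse (φ : PathMap G) : φ.reverse.length = φ.length := rfl

theorem vert_concat (φ ψ : PathMap G) (h) (i : ℕ) :
    (concat φ ψ h).vert i = if i ≤ φ.length then φ.vert i else ψ.vert (i - φ.length) := by
  by_cases hi : i ≤ φ.length + ψ.length
  · have := (concat φ ψ h).vert_val ⟨i, Nat.lt_succ_of_le hi⟩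
    rw [this]
    exact concatFun_eq φ ψ ⟨i, Nat.lt_succ_of_le hi⟩
  · rw [if_neg (by omega), ψ.vert_of_le (by omega),
      (concat φ ψ h).vert_of_le (by simp only [concat]; omega)]
    have h1 := concatFun_eq φ ψ (Fin.last _)
    have h2 : (concat φ ψ h).target = concatFun φ ψ (Fin.last _) := rfl
    rw [h2, h1]
    simp only [Fin.val_last]
    split_ifs with h3
    · rw [φ.vert_of_le (by omega), h, ← vert_zero, ψ.vert_of_le (by omega)]
    · rw [ψ.vert_of_le (by omega)]

theorem dir_concat (φ ψ : PathMap G) (h) (i : ℕ) :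
    (concat φ ψ h).dir i = if i < φ.length then φ.dir i else ψ.dir (i - φ.length) := by
  by_cases hi : i < φ.length + ψ.length
  · have := (concat φ ψ h).dir_val ⟨i, hi⟩
    rw [this]
    exact append_eq φ ψ ⟨i, hi⟩
  · rw [if_neg (by omega), dir, dif_neg (by simp only [concat]; omega), dir, dif_neg (by omega)]

theorem vert_reverse (φ : PathMap G) {i : ℕ} (hi : i ≤ φ.length) :
    φ.reverse.vert i = φ.vert (φ.length - i) := by
  have h1 := φ.reverse.vert_val ⟨i, Nat.lt_succ_of_le hi⟩
  have h2 := φ.vert_val (Fin.rev ⟨i, Nat.lt_succ_of_le hi⟩)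
  rw [show φ.length - i = (Fin.rev (⟨i, Nat.lt_succ_of_le hi⟩ : Fin (φ.length + 1)) : ℕ) by
    simp [Fin.val_rev]]
  rw [h2]
  exact h1

theorem dir_reverse (φ : PathMap G) {i : ℕ} (hi : i < φ.length) :
    φ.reverse.dir i = !φ.dir (φ.length - 1 - i) := by
  have h1 := φ.reverse.dir_val ⟨i, hi⟩
  have h2 := φ.dir_val (Fin.rev ⟨i, hi⟩)
  rw [show φ.length - 1 - i = (Fin.rev (⟨i, hi⟩ : Fin φ.length) : ℕ) by
    simp [Fin.val_rev]; omega]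
  rw [h2]
  exact h1

/-- The constant path-map of length zero. -/
def const (G : Digraph V) (b : V) : PathMap G where
  length := 0
  orient k := k.elim0
  toFun _ := b
  isDigraphMap := (isDigraphMap_line_iff _ _).2 fun k => k.elim0

theorem source_concat (φ ψ : PathMap G) (h) : (concat φ ψ h).source = φ.source := by
  rw [← vert_zero, vert_concat, if_pos (Nat.zero_le _), vert_zero]

theorem target_concat (φ ψ : PathMap G) (h) : (concat φ ψ h).target = ψ.target := by
  rw [← vert_of_le _ (i := φ.length + ψ.length + 1) (by simp only [concat]; omega), vert_concat,
    if_neg (by omega), vert_of_le _ (by omega)]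

theorem source_reverse (φ : PathMap G) : φ.reverse.source = φ.target := by
  rw [← vert_zero, vert_reverse _ (Nat.zero_le _), vert_of_le _ (by omega)]

theorem target_reverse (φ : PathMap G) : φ.reverse.target = φ.source := by
  rw [← vert_of_le φ.reverse (i := φ.length) le_rfl, vert_reverse _ le_rfl, Nat.sub_self,
    vert_zero]

end PathMap

/-! ### Shrinking maps through natural numbers -/

/-- The conditions on a shrinking map, on natural numbers. -/
structure NatShrink (φ ψ : PathMap G) (h : ℕ → ℕ) : Prop where
  zero : h 0 = 0
  last : h φ.length = ψ.length
  step : ∀ i < φ.length, h (i + 1) = h i ∨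
    (h (i + 1) = h i + 1 ∧ h i < ψ.length ∧ ψ.dir (h i) = φ.dir i)

theorem NatShrink.mono {φ ψ : PathMap G} {h : ℕ → ℕ} (H : NatShrink φ ψ h) {i j : ℕ}
    (hij : i ≤ j) (hj : j ≤ φ.length) : h i ≤ h j := by
  induction j, hij using Nat.le_induction with
  | base => exact le_rfl
  | succ j hij ih =>
    have := ih (by omega)
    rcases H.step j (by omega) with h1 | h1 <;> omega

theorem NatShrink.le {φ ψ : PathMap G} {h : ℕ → ℕ} (H : NatShrink φ ψ h) {i : ℕ}
    (hi : i ≤ φ.length) : h i ≤ ψ.length := H.last ▸ H.mono hi le_rfl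

theorem NatShrink.isShrinking {φ ψ : PathMap G} {h : ℕ → ℕ} (H : NatShrink φ ψ h) :
    IsShrinking φ.orient ψ.orient
      (fun i : Fin (φ.length + 1) => ⟨h i, Nat.lt_succ_of_le (H.le (Nat.le_of_lt_succ i.2))⟩) where
  map_zero := by ext; simpa using H.zero
  map_last := by ext; simpa using H.last
  monotone i j hij := by
    simpa using H.mono (show (i : ℕ) ≤ j from hij) (Nat.le_of_lt_succ j.2)
  isDigraphMap := by
    rw [isDigraphMap_line_iff]
    intro k
    rcases H.step k k.2 with h1 | ⟨h1, h2, h3⟩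
    · exact ⟨fun _ => Or.inl (by ext; simp [h1]), fun _ => Or.inl (by ext; simp [h1])⟩
    · rw [PathMap.dir_val, PathMap.dir, dif_pos h2] at h3
      refine ⟨fun h4 => Or.inr ⟨⟨h k, h2⟩, Or.inl ⟨h3.trans h4, ?_, ?_⟩⟩,
        fun h4 => Or.inr ⟨⟨h k, h2⟩, Or.inr ⟨h3.trans h4, ?_, ?_⟩⟩⟩ <;> ext <;> simp [h1]

theorem exists_natShrink {φ ψ : PathMap G} {h : Fin (φ.length + 1) → Fin (ψ.length + 1)}
    (H : IsShrinking φ.orient ψ.orient h) :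
    ∃ g : ℕ → ℕ, NatShrink φ ψ g ∧ ∀ i : Fin (φ.length + 1), g i = h i := by
  refine ⟨fun i => h ⟨min i φ.length, by omega⟩, ⟨?_, ?_, ?_⟩, ?_⟩
  · simpa using congrArg Fin.val H.map_zero
  · simpa [Fin.last] using congrArg Fin.val H.map_last
  · intro i hi
    have e1 : (⟨min i φ.length, by omega⟩ : Fin (φ.length + 1)) = (⟨i, hi⟩ : Fin _).castSucc := by
      ext; simp; omega
    have e2 : (⟨min (i + 1) φ.length, by omega⟩ : Fin (φ.length + 1)) =
        (⟨i, hi⟩ : Fin _).succ := by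
      ext; simp; omega
    have hm : h (⟨i, hi⟩ : Fin _).castSucc ≤ h (⟨i, hi⟩ : Fin _).succ :=
      H.monotone (by simp [Fin.le_def])
    simp only [e1, e2]
    have hd : φ.dir i = φ.orient ⟨i, hi⟩ := φ.dir_val ⟨i, hi⟩
    cases ho : φ.orient ⟨i, hi⟩
    · rcases H.isDigraphMap _ _ ⟨⟨i, hi⟩, Or.inr ⟨ho, rfl, rfl⟩⟩ with h1 | ⟨k, h1 | h1⟩
      · left; rw [h1]
      · obtain ⟨-, h2, h3⟩ := h1
        rw [h2, h3] at hm
        simp [Fin.le_def] at hm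
      · obtain ⟨h1, h2, h3⟩ := h1
        right
        rw [h2, h3, hd, ho]
        refine ⟨by simp, by simp, ?_⟩
        rw [← h1]
        exact ψ.dir_val k
    · rcases H.isDigraphMap _ _ ⟨⟨i, hi⟩, Or.inl ⟨ho, rfl, rfl⟩⟩ with h1 | ⟨k, h1 | h1⟩
      · left; rw [h1]
      · obtain ⟨h1, h2, h3⟩ := h1
        right
        rw [h2, h3, hd, ho]
        refine ⟨by simp, by simp, ?_⟩
        rw [← h1]
        exact ψ.dir_val k
      · obtain ⟨-, h2, h3⟩ := h1
        rw [h2, h3] at hm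
        simp [Fin.le_def] at hm
  · intro i
    simp only
    congr 2
    ext
    simp
    omega

theorem oneStepDirect_iff {φ ψ : PathMap G} : OneStepDirect φ ψ ↔ ∃ h : ℕ → ℕ,
    NatShrink φ ψ h ∧ ∀ i ≤ φ.length, EqOrAdj G (φ.vert i) (ψ.vert (h i)) := by
  constructor
  · rintro ⟨h, H, hF⟩
    obtain ⟨g, hg, hgh⟩ := exists_natShrink H
    refine ⟨g, hg, fun i hi => ?_⟩
    have h1 : g i = h ⟨i, Nat.lt_succ_of_le hi⟩ := hgh ⟨i, Nat.lt_succ_of_le hi⟩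
    have h2 := hF (.inl ⟨i, Nat.lt_succ_of_le hi⟩) (.inr (h ⟨i, Nat.lt_succ_of_le hi⟩)) rfl
    simp only [Sum.elim_inl, Sum.elim_inr, ← PathMap.vert_val] at h2
    rw [h1]
    exact h2
  · rintro ⟨h, H, hF⟩
    refine ⟨_, H.isShrinking, ?_⟩
    rintro (x | x) (y | y) hxy
    · exact φ.isDigraphMap _ _ hxy
    · simp only [cylinder] at hxy
      subst hxy
      simpa only [Sum.elim_inl, Sum.elim_inr, ← PathMap.vert_val] using
        hF x (Nat.le_of_lt_succ x.2)
    · exact hxy.elim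
    · exact ψ.isDigraphMap _ _ hxy

theorem oneStepInverse_iff {φ ψ : PathMap G} : OneStepInverse φ ψ ↔ ∃ h : ℕ → ℕ,
    NatShrink φ ψ h ∧ ∀ i ≤ φ.length, EqOrAdj G (ψ.vert (h i)) (φ.vert i) := by
  constructor
  · rintro ⟨h, H, hF⟩
    obtain ⟨g, hg, hgh⟩ := exists_natShrink H
    refine ⟨g, hg, fun i hi => ?_⟩
    have h1 : g i = h ⟨i, Nat.lt_succ_of_le hi⟩ := hgh ⟨i, Nat.lt_succ_of_le hi⟩
    have h2 := hF (.inr (h ⟨i, Nat.lt_succ_of_le hi⟩)) (.inl ⟨i, Nat.lt_succ_of_le hi⟩) rfl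
    simp only [Sum.elim_inl, Sum.elim_inr, ← PathMap.vert_val] at h2
    rw [h1]
    exact h2
  · rintro ⟨h, H, hF⟩
    refine ⟨_, H.isShrinking, ?_⟩
    rintro (x | x) (y | y) hxy
    · exact φ.isDigraphMap _ _ hxy
    · exact hxy.elim
    · simp only [invCylinder] at hxy
      subst hxy
      simpa only [Sum.elim_inl, Sum.elim_inr, ← PathMap.vert_val] using
        hF y (Nat.le_of_lt_succ y.2)
    · exact ψ.isDigraphMap _ _ hxy

/-! ### The group structure -/

/-- A one-step `C`-homotopy from `φ` to `ψ`, direct or inverse. -/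
def OneStep (φ ψ : PathMap G) : Prop := OneStepDirect φ ψ ∨ OneStepInverse φ ψ

/-- `C`-homotopy of loops. -/
def CHomotopic (φ ψ : Loop G b) : Prop := Relation.EqvGen (loopDigraph G b).Adj φ ψ

theorem CHomotopic.of_oneStep {φ ψ : Loop G b} (h : OneStep φ.toPathMap ψ.toPathMap) :
    CHomotopic φ ψ := by
  by_cases hne : φ = ψ
  · subst hne; exact .refl _
  · rcases h with h | h
    · exact .rel _ _ ⟨hne, Or.inl h⟩
    · exact .symm _ _ (.rel _ _ ⟨Ne.symm hne, Or.inr h⟩)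

theorem CHomotopic.map {F : Loop G b → Loop G b}
    (hF : ∀ φ ψ : Loop G b, OneStep φ.toPathMap ψ.toPathMap →
      OneStep (F φ).toPathMap (F ψ).toPathMap)
    {φ ψ : Loop G b} (h : CHomotopic φ ψ) : CHomotopic (F φ) (F ψ) := by
  induction h with
  | rel φ ψ h =>
    rcases h.2 with h | h
    · exact .of_oneStep (hF _ _ (Or.inl h))
    · exact .symm _ _ (CHomotopic.of_oneStep (hF _ _ (Or.inr h)))
  | refl => exact .refl _
  | symm _ _ _ ih => exact .symm _ _ ih
  | trans _ _ _ _ _ ih1 ih2 => exact .trans _ _ _ ih1 ih2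

/-- One-step `C`-homotopies are transported along operations that act on shrinking maps. -/
theorem OneStep.transport {φ ψ φ' ψ' : PathMap G} (T : (ℕ → ℕ) → ℕ → ℕ)
    (hT : ∀ h, NatShrink φ ψ h → NatShrink φ' ψ' (T h))
    (hv : ∀ h, NatShrink φ ψ h → ∀ i ≤ φ'.length,
      (∃ j ≤ φ.length, φ'.vert i = φ.vert j ∧ ψ'.vert (T h i) = ψ.vert (h j)) ∨
      φ'.vert i = ψ'.vert (T h i))
    (H : OneStep φ ψ) : OneStep φ' ψ' := by
  rcases H with H | H
  · obtain ⟨h, h1, h2⟩ := oneStepDirect_iff.1 H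
    refine Or.inl (oneStepDirect_iff.2 ⟨T h, hT h h1, fun i hi => ?_⟩)
    rcases hv h h1 i hi with ⟨j, hj, e1, e2⟩ | e
    · rw [e1, e2]; exact h2 j hj
    · exact Or.inl e
  · obtain ⟨h, h1, h2⟩ := oneStepInverse_iff.1 H
    refine Or.inr (oneStepInverse_iff.2 ⟨T h, hT h h1, fun i hi => ?_⟩)
    rcases hv h h1 i hi with ⟨j, hj, e1, e2⟩ | e
    · rw [e1, e2]; exact h2 j hj
    · exact Or.inl e.symm

theorem oneStep_of_eq {φ ψ : PathMap G} (hl : φ.length = ψ.length)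
    (hv : ∀ i ≤ φ.length, φ.vert i = ψ.vert i) (hd : ∀ i < φ.length, φ.dir i = ψ.dir i) :
    OneStep φ ψ :=
  Or.inl (oneStepDirect_iff.2 ⟨id, ⟨rfl, hl, fun i hi => Or.inr ⟨rfl, hl ▸ hi, (hd i hi).symm⟩⟩,
    fun i hi => Or.inl (hv i hi)⟩)

namespace Loop

/-- The concatenation of loops. -/
def concat (φ ψ : Loop G b) : Loop G b where
  toPathMap := φ.toPathMap.concat ψ.toPathMap (φ.target_eq.trans ψ.source_eq.symm)
  source_eq := by rw [PathMap.source_concat, φ.source_eq]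
  target_eq := by rw [PathMap.target_concat, ψ.target_eq]

/-- The inverse loop. -/
def reverse (φ : Loop G b) : Loop G b where
  toPathMap := φ.toPathMap.reverse
  source_eq := by rw [PathMap.source_reverse, φ.target_eq]
  target_eq := by rw [PathMap.target_reverse, φ.source_eq]

/-- The trivial loop, of length zero. -/
def trivial (G : Digraph V) (b : V) : Loop G b where
  toPathMap := PathMap.const G b
  source_eq := rfl
  target_eq := rfl

end Loop

theorem oneStep_concat_left {φ φ' ψ : PathMap G} (h1 : φ.target = ψ.source)
    (h2 : φ'.target = ψ.source) (H : OneStep φ φ') :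
    OneStep (φ.concat ψ h1) (φ'.concat ψ h2) := by
  refine H.transport
    (fun h i => if i ≤ φ.length then h i else i - φ.length + φ'.length) ?_ ?_
  · intro h hh
    refine ⟨?_, ?_, ?_⟩
    · simpa using hh.zero
    · have := hh.last
      rw [PathMap.length_concat, PathMap.length_concat]
      split_ifs with h3
      · rw [show φ.length + ψ.length = φ.length by omega]; omega
      · omega
    · intro i hi
      simp only [PathMap.length_concat] at hi
      simp only [PathMap.dir_concat]
      simp only [PathMap.length_concat]
      rcases lt_or_ge i φ.length with h3 | h3
      · rw [if_pos (by omega), if_pos h3.le, if_pos h3]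
        rcases hh.step i h3 with h4 | ⟨h4, h5, h6⟩
        · exact Or.inl h4
        · exact Or.inr ⟨h4, by omega, by rw [if_pos h5, h6]⟩
      · rw [if_neg (by omega), if_neg (by omega : ¬ i < φ.length)]
        have e : (if i ≤ φ.length then h i else i - φ.length + φ'.length)
            = i - φ.length + φ'.length := by
          split_ifs with h4
          · have : i = φ.length := by omega
            subst this
            rw [hh.last]; omega
          · rfl
        rw [e, if_neg (by omega)]
        refine Or.inr ⟨by omega, by omega, ?_⟩
        congr 1
        omega
  · intro h hh i hi
    simp only [PathMap.vert_concat]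
    by_cases h3 : i ≤ φ.length
    · left
      refine ⟨i, h3, by rw [if_pos h3], ?_⟩
      rw [if_pos h3, if_pos (hh.le h3)]
    · right
      rw [if_neg h3, if_neg h3, if_neg (by omega)]
      congr 1
      omega

theorem oneStep_concat_right {φ ψ ψ' : PathMap G} (h1 : φ.target = ψ.source)
    (h2 : φ.target = ψ'.source) (H : OneStep ψ ψ') :
    OneStep (φ.concat ψ h1) (φ.concat ψ' h2) := by
  refine H.transport
    (fun h i => if i ≤ φ.length then i else φ.length + h (i - φ.length)) ?_ ?_
  · intro h hh
    refine ⟨?_, ?_, ?_⟩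
    · simp
    · have := hh.last
      have h0 := hh.zero
      rw [PathMap.length_concat, PathMap.length_concat]
      split_ifs with h3
      · have h4 : ψ.length = 0 := by omega
        rw [h4, h0] at this
        omega
      · rw [Nat.add_sub_cancel_left, this]
    · intro i hi
      simp only [PathMap.length_concat] at hi
      simp only [PathMap.dir_concat]
      simp only [PathMap.length_concat]
      rcases lt_or_ge i φ.length with h3 | h3
      · rw [if_pos (by omega), if_pos h3.le, if_pos h3, if_pos h3]
        exact Or.inr ⟨rfl, by omega, rfl⟩
      · rw [if_neg (by omega), if_neg (by omega : ¬ i < φ.length)]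
        have e : (if i ≤ φ.length then i else φ.length + h (i - φ.length))
            = φ.length + h (i - φ.length) := by
          split_ifs with h4
          · have : i = φ.length := by omega
            subst this
            rw [Nat.sub_self, hh.zero]; omega
          · rfl
        rw [e, if_neg (by omega), Nat.add_sub_cancel_left,
          show i + 1 - φ.length = i - φ.length + 1 by omega]
        rcases hh.step (i - φ.length) (by omega) with h4 | ⟨h4, h5, h6⟩
        · left; omega
        · exact Or.inr ⟨by omega, by omega, h6⟩
  · intro h hh i hi
    simp only [PathMap.length_concat] at hi
    simp only [PathMap.vert_concat]
    by_cases h3 : i ≤ φ.length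
    · right
      simp [h3]
    · left
      refine ⟨i - φ.length, by omega, by rw [if_neg h3], ?_⟩
      rw [if_neg h3]
      split_ifs with h4
      · have h5 : h (i - φ.length) = 0 := by omega
        rw [h5, Nat.add_zero, PathMap.vert_of_le _ le_rfl, h2, PathMap.vert_zero]
      · rw [Nat.add_sub_cancel_left]

theorem oneStep_reverse {φ ψ : PathMap G} (H : OneStep φ ψ) : OneStep φ.reverse ψ.reverse := by
  refine H.transport (fun h i => ψ.length - h (φ.length - i)) ?_ ?_
  · intro h hh
    refine ⟨?_, ?_, ?_⟩
    · simp [hh.last]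
    · simp [PathMap.reverse, hh.zero]
    · intro i hi
      simp only [PathMap.length_reverse] at hi
      have hs := hh.step (φ.length - 1 - i) (by omega)
      have hb := hh.le (i := φ.length - i) (by omega)
      rw [show φ.length - 1 - i + 1 = φ.length - i by omega] at hs
      rw [show φ.length - (i + 1) = φ.length - 1 - i by omega]
      rcases hs with h1 | ⟨h1, h2, h3⟩
      · left; omega
      · right
        refine ⟨by omega, by simp only [PathMap.length_reverse]; omega, ?_⟩
        rw [PathMap.dir_reverse _ (by omega), PathMap.dir_reverse _ hi, ← h3]
        congr 2
        omega
  · intro h hh i hi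
    left
    have hb := hh.le (i := φ.length - i) (by omega)
    refine ⟨φ.length - i, by omega, PathMap.vert_reverse _ hi, ?_⟩
    rw [PathMap.vert_reverse _ (by omega)]
    congr 1
    omega

/-- The loop that runs along the first `k` edges of `φ` and back. -/
def foldLoop (φ : Loop G b) (k : ℕ) : Loop G b where
  toPathMap := PathMap.ofNat (2 * k)
    (fun i => if i ≤ k then φ.vert i else φ.vert (2 * k - i))
    (fun i => if i < k then φ.dir i else !φ.dir (2 * k - 1 - i)) (by
      intro i hi
      have := φ.step i
      have h' := φ.step (2 * k - 1 - i)
      rcases lt_or_ge i k with h | h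
      · simpa [h, h.le, Nat.succ_le_of_lt h] using this
      · have e : (if i ≤ k then φ.vert i else φ.vert (2 * k - i)) = φ.vert (2 * k - i) := by
          split_ifs
          · congr 1; omega
          · rfl
        rw [if_neg (by omega), e, if_neg (by omega), show 2 * k - (i + 1) = 2 * k - 1 - i by omega]
        rw [show 2 * k - 1 - i + 1 = 2 * k - i by omega] at h'
        simpa [and_comm] using h')
  source_eq := by
    rw [← PathMap.vert_zero, PathMap.vert_ofNat (by omega), if_pos (by omega), PathMap.vert_zero,
      φ.source_eq]
  target_eq := by
    rw [← PathMap.vert_of_le _ (i := 2 * k) le_rfl, PathMap.vert_ofNat (by omega)]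
    split_ifs with h
    · rw [show 2 * k = 0 by omega, PathMap.vert_zero, φ.source_eq]
    · rw [Nat.sub_self, PathMap.vert_zero, φ.source_eq]

theorem foldLoop_succ (φ : Loop G b) (k : ℕ) :
    OneStep (foldLoop φ (k + 1)).toPathMap (foldLoop φ k).toPathMap := by
  have hs : NatShrink (foldLoop φ (k + 1)).toPathMap (foldLoop φ k).toPathMap
      (fun i => if i ≤ k then i else if i ≤ k + 2 then k else i - 2) := by
    refine ⟨by simp, ?_, ?_⟩
    · change (if 2 * (k + 1) ≤ k then 2 * (k + 1) else if 2 * (k + 1) ≤ k + 2 then k else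
        2 * (k + 1) - 2) = 2 * k
      split_ifs <;> omega
    · intro i hi
      change i < 2 * (k + 1) at hi
      change _ ∨ (_ ∧ _ < 2 * k ∧ _)
      rcases lt_or_ge i k with h | h
      · right
        simp only [if_pos h.le, if_pos (show i + 1 ≤ k from h)]
        refine ⟨trivial, by omega, ?_⟩
        simp only [foldLoop]
        rw [PathMap.dir_ofNat (by omega), PathMap.dir_ofNat (by omega), if_pos h,
          if_pos (by omega)]
      · rcases lt_or_ge i (k + 2) with h' | h'
        · left
          split_ifs <;> omega
        · right
          have e : (if i ≤ k then i else if i ≤ k + 2 then k else i - 2) = i - 2 := by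
            split_ifs <;> omega
          have e' : (if i + 1 ≤ k then i + 1 else if i + 1 ≤ k + 2 then k else i + 1 - 2)
              = i - 1 := by
            split_ifs <;> omega
          simp only [e, e']
          refine ⟨by omega, by omega, ?_⟩
          simp only [foldLoop]
          rw [PathMap.dir_ofNat (by omega), PathMap.dir_ofNat (by omega), if_neg (by omega),
            if_neg (by omega)]
          congr 2
          omega
  have hv : ∀ i ≤ (foldLoop φ (k + 1)).length,
      ((foldLoop φ (k + 1)).vert i = φ.vert (k + 1) ∧
        (foldLoop φ k).vert (if i ≤ k then i else if i ≤ k + 2 then k else i - 2) = φ.vert k) ∨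
      (foldLoop φ (k + 1)).vert i =
        (foldLoop φ k).vert (if i ≤ k then i else if i ≤ k + 2 then k else i - 2) := by
    intro i hi
    change i ≤ 2 * (k + 1) at hi
    have hle : (if i ≤ k then i else if i ≤ k + 2 then k else i - 2) ≤ 2 * k := by
      split_ifs <;> omega
    simp only [foldLoop]
    rw [PathMap.vert_ofNat hi, PathMap.vert_ofNat hle]
    by_cases h1 : i = k + 1
    · left
      subst h1
      simp
    · right
      by_cases h2 : i ≤ k
      · simp [h2, Nat.le_succ_of_le h2]
      · rw [if_neg (by omega)]
        by_cases h3 : i ≤ k + 2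
        · have : i = k + 2 := by omega
          subst this
          simp only [if_neg h2, le_refl, if_true]
          congr 1
          omega
        · simp only [if_neg h2, if_neg h3]
          split_ifs with h4
          · congr 1; omega
          · congr 1; omega
  have hst := φ.step k
  cases hd : φ.dir k
  · left
    refine oneStepDirect_iff.2 ⟨_, hs, fun i hi => ?_⟩
    rcases hv i hi with ⟨e1, e2⟩ | e
    · rw [e1, e2]; exact hst.2 hd
    · exact Or.inl e
  · right
    refine oneStepInverse_iff.2 ⟨_, hs, fun i hi => ?_⟩
    rcases hv i hi with ⟨e1, e2⟩ | e
    · rw [e1, e2]; exact hst.1 hd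
    · exact Or.inl e.symm

theorem foldLoop_chomotopic (φ : Loop G b) (k : ℕ) :
    CHomotopic (foldLoop φ k) (Loop.trivial G b) := by
  induction k with
  | zero =>
    refine .of_oneStep (oneStep_of_eq rfl ?_ ?_)
    · intro i hi
      have h0 : i = 0 := Nat.le_zero.1 hi
      subst h0
      rw [PathMap.vert_zero, PathMap.vert_zero, Loop.source_eq, Loop.source_eq]
    · intro i hi
      exact absurd hi (Nat.not_lt_zero i)
  | succ k ih => exact .trans _ _ _ (CHomotopic.of_oneStep (foldLoop_succ φ k)) ih

theorem concat_reverse_chomotopic (φ : Loop G b) :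
    CHomotopic (φ.concat φ.reverse) (Loop.trivial G b) := by
  refine .trans _ _ _ (CHomotopic.of_oneStep (oneStep_of_eq ?_ ?_ ?_)) (foldLoop_chomotopic φ φ.length)
  · change φ.length + φ.length = 2 * φ.length
    omega
  · intro i hi
    change i ≤ φ.length + φ.length at hi
    simp only [foldLoop, Loop.concat, Loop.reverse]
    rw [PathMap.vert_ofNat (by omega), PathMap.vert_concat]
    split_ifs with h
    · rfl
    · rw [PathMap.vert_reverse _ (by omega)]
      congr 1
      omega
  · intro i hi
    change i < φ.length + φ.length at hi
    simp only [foldLoop, Loop.concat, Loop.reverse]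
    rw [PathMap.dir_ofNat (by omega), PathMap.dir_concat]
    split_ifs with h
    · rfl
    · rw [PathMap.dir_reverse _ (by omega)]
      congr 2
      omega

theorem reverse_concat_chomotopic (φ : Loop G b) :
    CHomotopic (φ.reverse.concat φ) (Loop.trivial G b) := by
  have h : OneStep φ.toPathMap φ.reverse.reverse.toPathMap := oneStep_of_eq rfl ?_ ?_
  · exact .trans _ _ _ (CHomotopic.of_oneStep (ψ := φ.reverse.concat φ.reverse.reverse)
      (oneStep_concat_right (φ.reverse.target_eq.trans φ.source_eq.symm)
        (φ.reverse.target_eq.trans φ.reverse.reverse.source_eq.symm) h))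
      (concat_reverse_chomotopic φ.reverse)
  · intro i hi
    simp only [Loop.reverse]
    rw [PathMap.vert_reverse _ (by exact hi), PathMap.vert_reverse _ (by simp [PathMap.reverse])]
    congr 1
    simp only [PathMap.length_reverse]
    omega
  · intro i hi
    simp only [Loop.reverse]
    rw [PathMap.dir_reverse _ (by exact hi),
      PathMap.dir_reverse _ (by simp only [PathMap.length_reverse]; omega), Bool.not_not]
    congr 1
    simp only [PathMap.length_reverse]
    omega

theorem concat_assoc_chomotopic (φ ψ χ : Loop G b) :
    CHomotopic ((φ.concat ψ).concat χ) (φ.concat (ψ.concat χ)) := by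
  refine .of_oneStep (oneStep_of_eq (Nat.add_assoc _ _ _) ?_ ?_)
  · intro i _
    simp only [Loop.concat, PathMap.vert_concat, PathMap.length_concat, Nat.sub_sub]
    by_cases h1 : i ≤ φ.length
    · rw [if_pos (by omega), if_pos h1, if_pos h1]
    · by_cases h2 : i ≤ φ.length + ψ.length
      · rw [if_pos h2, if_neg h1, if_neg h1, if_pos (by omega)]
      · rw [if_neg h2, if_neg h1, if_neg (by omega)]
  · intro i _
    simp only [Loop.concat, PathMap.dir_concat, PathMap.length_concat, Nat.sub_sub]
    by_cases h1 : i < φ.length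
    · rw [if_pos (by omega), if_pos h1, if_pos h1]
    · by_cases h2 : i < φ.length + ψ.length
      · rw [if_pos h2, if_neg h1, if_neg h1, if_pos (by omega)]
      · rw [if_neg h2, if_neg h1, if_neg (by omega)]

theorem trivial_concat_chomotopic (φ : Loop G b) :
    CHomotopic ((Loop.trivial G b).concat φ) φ := by
  refine .of_oneStep (oneStep_of_eq (Nat.zero_add _) ?_ ?_)
  · intro i _
    simp only [Loop.concat, PathMap.vert_concat]
    split_ifs with h
    · have h0 : i = 0 := Nat.le_zero.1 h
      subst h0
      rw [PathMap.vert_zero, PathMap.vert_zero, Loop.source_eq, Loop.source_eq]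
    · rfl
  · intro i _
    simp only [Loop.concat, PathMap.dir_concat]
    rw [if_neg (by exact Nat.not_lt_zero i)]
    rfl

/-- The group structure on `π₁(G, b)`: the product is induced by concatenation, the neutral element
is the class of the trivial loop, and the inverse is induced by reversal. -/
instance (G : Digraph V) (b : V) : Group (FundamentalGroup G b) where
  mul := Quotient.map₂ Loop.concat (fun φ φ' h ψ ψ' h' => by
    refine Relation.EqvGen.trans _ (φ'.concat ψ) _ ?_ ?_
    · exact CHomotopic.map (F := fun φ => φ.concat ψ)
        (fun x y H => oneStep_concat_left (x.target_eq.trans ψ.source_eq.symm)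
          (y.target_eq.trans ψ.source_eq.symm) H) h
    · exact CHomotopic.map (F := fun ψ => φ'.concat ψ)
        (fun x y H => oneStep_concat_right (φ'.target_eq.trans x.source_eq.symm)
          (φ'.target_eq.trans y.source_eq.symm) H) h')
  one := Quotient.mk _ (Loop.trivial G b)
  inv := Quotient.map Loop.reverse (fun _ _ h =>
    CHomotopic.map (F := Loop.reverse) (fun _ _ H => oneStep_reverse H) h)
  mul_assoc := by
    rintro ⟨φ⟩ ⟨ψ⟩ ⟨χ⟩
    exact Quotient.sound (concat_assoc_chomotopic φ ψ χ)
  one_mul := by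
    rintro ⟨φ⟩
    exact Quotient.sound (trivial_concat_chomotopic φ)
  mul_one := by
    rintro ⟨φ⟩
    refine Quotient.sound (CHomotopic.of_oneStep (oneStep_of_eq rfl ?_ ?_))
    · intro i hi
      simp only [Loop.concat, PathMap.vert_concat]
      rw [if_pos (by exact hi)]
    · intro i hi
      simp only [Loop.concat, PathMap.dir_concat]
      rw [if_pos (by exact hi)]
  inv_mul_cancel := by
    rintro ⟨φ⟩
    exact Quotient.sound (reverse_concat_chomotopic φ)

/-! ### Path homology -/

section Homology

variable (K : Type v) [CommRing K]

/-- An elementary `p`-path `i₀ … i_p` is regular if consecutive vertices are distinct. -/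
def IsRegularPath {p : ℕ} (i : Fin (p + 1) → V) : Prop := ∀ k : Fin p, i k.castSucc ≠ i k.succ

/-- The module `R_p` of regular `p`-paths: formal `K`-linear combinations of regular elementary
`p`-paths. -/
abbrev RegularPaths (V : Type u) (p : ℕ) : Type (max u v) :=
  {i : Fin (p + 1) → V // IsRegularPath i} →₀ K

noncomputable instance (V : Type u) (p : ℕ) : AddCommGroup (RegularPaths K V p) :=
  Finsupp.instAddCommGroup

open Classical in
/-- The element `e_i` of `R_p`; irregular paths are set equal to zero. -/
noncomputable def elem {p : ℕ} (i : Fin (p + 1) → V) : RegularPaths K V p :=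
  if h : IsRegularPath i then Finsupp.single ⟨i, h⟩ 1 else 0

/-- The boundary operator `R_{p+1} → R_p`, with
`∂ e_{i₀ … i_{p+1}} = ∑_q (-1)^q e_{i₀ … î_q … i_{p+1}}`. -/
noncomputable def boundary (V : Type u) (p : ℕ) :
    RegularPaths K V (p + 1) →ₗ[K] RegularPaths K V p :=
  Finsupp.linearCombination K fun i =>
    ∑ q : Fin (p + 2), (-1 : K) ^ (q : ℕ) • elem K (q.removeNth i.1)

/-- The module `A_p` of allowed `p`-paths: the span of the `e_{i₀ … i_p}` with `i_k → i_{k+1}` for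
all `k`. -/
noncomputable def allowedPaths (G : Digraph V) (p : ℕ) : Submodule K (RegularPaths K V p) :=
  Submodule.span K {x | ∃ i : Fin (p + 1) → V,
    (∀ k : Fin p, G.Adj (i k.castSucc) (i k.succ)) ∧ x = elem K i}

/-- The module `Ω_p` of `∂`-invariant `p`-paths: the allowed `p`-paths with allowed boundary, where
the boundary of a `0`-path is zero. -/
noncomputable def invariantPaths (G : Digraph V) : (p : ℕ) → Submodule K (RegularPaths K V p)
  | 0 => allowedPaths K G 0
  | p + 1 => allowedPaths K G (p + 1) ⊓ (allowedPaths K G p).comap (boundary K V p)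

/-- The kernel of `∂` on `Ω_p`, where the boundary of a `0`-path is zero. -/
noncomputable def cycles (G : Digraph V) : (p : ℕ) → Submodule K (RegularPaths K V p)
  | 0 => invariantPaths K G 0
  | p + 1 => invariantPaths K G (p + 1) ⊓ LinearMap.ker (boundary K V p)

/-- The image of `∂` on `Ω_{p+1}`. -/
noncomputable def boundaries (G : Digraph V) (p : ℕ) : Submodule K (RegularPaths K V p) :=
  (invariantPaths K G (p + 1)).map (boundary K V p)

/-- The path homology `H_p(G, K) = ker ∂|Ω_p / im ∂|Ω_{p+1}`. -/
abbrev PathHomology (G : Digraph V) (p : ℕ) : Type (max u v) :=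
  cycles K G p ⧸ (boundaries K G p).submoduleOf (cycles K G p)

end Homology

end DigraphHomotopy

namespace DigraphHomotopy

universe u v

variable {V : Type u} {G : Digraph V} {b : V}

/-! The Hurewicz map sends a loop to the signed sum of its edges, a `1`-cycle. A one-step homotopy
is a ladder between two path-maps whose cells are triangles and squares, possibly degenerate. The
two sides `a → c → e` and `a → d → e` of a square agree modulo `∂(e_{ace} - e_{ade})`, where the
term `e_{ae}` cancels, so this `2`-path is invariant even when `a → e` is not an edge. Hence the sum
along a loop is a homotopy invariant modulo boundaries (`isSquareInvariant_mkQ_elemEdge`,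
`IsSquareInvariant.pathSum_eq`).

For the inverse, choose a path `p v` from `b` to every vertex and close each edge up to a loop at
`b`. In the abelianized group this gives a function on edges that respects squares
(`basedClass_square`). The difficulty is to see that it kills `∂Ω_2` without a list of generators of
`Ω_2`. The remedy is to extend the function to every pair `(a, e)` joined by a directed two-step
path, by the sum of the two edge classes (`diagClass`). The square relation makes this independent
of the midpoint, and the linear extension then kills the boundary of each single allowed path
`e_{ace}`, invariant or not (`diagLift_boundary`).

In one composite a loop becomes the product of its closed-up edges, which telescopes to a conjugate
of the loop. In the other, an edge chain `x` becomes `x - cone (∂x)`, which is `x` when `x` is a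
cycle (`hurewicz_diagLift`). -/

theorem EqOrAdj.refl (G : Digraph V) (a : V) : EqOrAdj G a a := Or.inl rfl

/-! ### Strict identities for path-maps, single edges and initial segments. -/

namespace PathMap

/-- Upgrades the criterion of `oneStep_of_eq` to an equality, so that associativity and the right
unit law hold on the nose and paths can be rebracketed by rewriting. -/
theorem ext_vert_dir {φ ψ : PathMap G} (hl : φ.length = ψ.length)
    (hv : ∀ i ≤ φ.length, φ.vert i = ψ.vert i) (hd : ∀ i < φ.length, φ.dir i = ψ.dir i) :
    φ = ψ := by
  obtain ⟨n, o, f, hf⟩ := φ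
  obtain ⟨m, o', f', hf'⟩ := ψ
  obtain rfl : n = m := hl
  obtain rfl : f = f' := funext fun i => by
    have := hv i (Nat.le_of_lt_succ i.2)
    rwa [vert_val ⟨n, o, f, hf⟩ i, vert_val ⟨n, o', f', hf'⟩ i] at this
  obtain rfl : o = o' := funext fun i => by
    have := hd i i.2
    rwa [dir_val ⟨n, o, f, hf⟩ i, dir_val ⟨n, o', f, hf'⟩ i] at this
  rfl

theorem concat_assoc (φ ψ χ : PathMap G) (h₁ h₂ h₃ h₄) :
    (φ.concat ψ h₁).concat χ h₂ = φ.concat (ψ.concat χ h₃) h₄ := by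
  refine ext_vert_dir (Nat.add_assoc _ _ _) ?_ ?_
  · intro i _
    simp only [vert_concat, length_concat, Nat.sub_sub]
    by_cases h1 : i ≤ φ.length
    · rw [if_pos (by omega), if_pos h1, if_pos h1]
    · by_cases h2 : i ≤ φ.length + ψ.length
      · rw [if_pos h2, if_neg h1, if_neg h1, if_pos (by omega)]
      · rw [if_neg h2, if_neg h1, if_neg (by omega)]
  · intro i _
    simp only [dir_concat, length_concat, Nat.sub_sub]
    by_cases h1 : i < φ.length
    · rw [if_pos (by omega), if_pos h1, if_pos h1]
    · by_cases h2 : i < φ.length + ψ.length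
      · rw [if_pos h2, if_neg h1, if_neg h1, if_pos (by omega)]
      · rw [if_neg h2, if_neg h1, if_neg (by omega)]

theorem reverse_reverse (φ : PathMap G) : φ.reverse.reverse = φ := by
  obtain ⟨n, o, f, hf⟩ := φ
  simp [reverse]

theorem concat_const (φ : PathMap G) (a : V) (h) : φ.concat (const G a) h = φ := by
  refine ext_vert_dir rfl ?_ ?_
  · intro i hi
    rw [vert_concat, if_pos (by exact hi)]
  · intro i hi
    rw [dir_concat, if_pos (by exact hi)]

/-- The path-map of length one along `a → c`, constant if `a = c`. -/
def edge {a c : V} (h : EqOrAdj G a c) : PathMap G :=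
  ofNat 1 (fun i => if i = 0 then a else c) (fun _ => true) (by
    intro i hi
    obtain rfl : i = 0 := by omega
    simpa using h)

theorem length_edge {a c : V} (h : EqOrAdj G a c) : (edge h).length = 1 := rfl

theorem vert_edge {a c : V} (h : EqOrAdj G a c) (i : ℕ) :
    (edge h).vert i = if i = 0 then a else c := by
  rcases i with _ | i
  · rfl
  · simp [vert, edge, ofNat]

theorem dir_edge {a c : V} (h : EqOrAdj G a c) (i : ℕ) : (edge h).dir i = true := by
  unfold dir
  split_ifs <;> rfl

/-- The initial segment of length `k` of a path-map. -/
def take (φ : PathMap G) (k : ℕ) : PathMap G := ofNat k φ.vert φ.dir fun i _ => φ.step i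

theorem source_take (φ : PathMap G) (k : ℕ) : (φ.take k).source = φ.source := φ.vert_zero

theorem target_take (φ : PathMap G) (k : ℕ) : (φ.take k).target = φ.vert k := rfl

theorem length_take (φ : PathMap G) (k : ℕ) : (φ.take k).length = k := rfl

theorem vert_take (φ : PathMap G) {i k : ℕ} (hi : i ≤ k) : (φ.take k).vert i = φ.vert i :=
  vert_ofNat hi

theorem dir_take (φ : PathMap G) {i k : ℕ} (hi : i < k) : (φ.take k).dir i = φ.dir i :=
  dir_ofNat hi

theorem take_length (φ : PathMap G) : φ.take φ.length = φ :=
  ext_vert_dir rfl (fun _ hi => vert_take φ hi) (fun _ hi => dir_take φ hi)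

theorem take_zero (φ : PathMap G) : φ.take 0 = const G φ.source :=
  ext_vert_dir rfl (fun i hi => by
    obtain rfl : i = 0 := Nat.le_zero.1 hi
    rw [vert_take φ le_rfl, vert_zero]
    rfl) (fun _ hi => absurd hi (Nat.not_lt_zero _))

/-- With its counterpart for `false`, this decomposes a path-map into forward and reversed edges; it
is the inductive step of `abClass_take`. -/
theorem take_succ_of_true (φ : PathMap G) (k : ℕ) (hd : φ.dir k = true) (h) :
    φ.take (k + 1) = (φ.take k).concat (edge ((φ.step k).1 hd)) h := by
  refine ext_vert_dir rfl ?_ ?_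
  · intro i hi
    rw [length_take] at hi
    rw [vert_concat, vert_take φ hi, length_take]
    split_ifs with h
    · exact (vert_take φ h).symm
    · rw [vert_edge, if_neg (by omega), show i = k + 1 by omega]
  · intro i hi
    rw [length_take] at hi
    rw [dir_concat, dir_take φ hi, length_take]
    split_ifs with h
    · exact (dir_take φ h).symm
    · rw [dir_edge, ← hd, show i = k by omega]

theorem take_succ_of_false (φ : PathMap G) (k : ℕ) (hd : φ.dir k = false) (h) :
    φ.take (k + 1) = (φ.take k).concat (edge ((φ.step k).2 hd)).reverse h := by
  refine ext_vert_dir rfl ?_ ?_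
  · intro i hi
    rw [length_take] at hi
    rw [vert_concat, vert_take φ hi, length_take]
    split_ifs with h
    · exact (vert_take φ h).symm
    · obtain rfl : i = k + 1 := by omega
      rw [vert_reverse _ (by rw [length_edge]; omega), vert_edge, length_edge, if_pos (by omega)]
  · intro i hi
    rw [length_take] at hi
    rw [dir_concat, dir_take φ hi, length_take]
    split_ifs with h
    · exact (dir_take φ h).symm
    · rw [dir_reverse _ (by rw [length_edge]; omega), dir_edge, Bool.not_true, ← hd,
        show i = k by omega]

end PathMap

theorem oneStep_of_eqOrAdj {φ ψ : PathMap G} (hl : φ.length = ψ.length)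
    (hv : ∀ i ≤ φ.length, EqOrAdj G (φ.vert i) (ψ.vert i))
    (hd : ∀ i < φ.length, φ.dir i = ψ.dir i) : OneStep φ ψ :=
  Or.inl (oneStepDirect_iff.2 ⟨id, ⟨rfl, hl, fun i hi => Or.inr ⟨rfl, hl ▸ hi, (hd i hi).symm⟩⟩, hv⟩)

/-! ### Path-maps with fixed end vertices -/

/-- A path-map from `v` to `w`. -/
structure Path (G : Digraph V) (v w : V) extends PathMap G where
  source_eq : toPathMap.source = v
  target_eq : toPathMap.target = w

namespace Path

variable {v w x y : V}

theorem ext_toPathMap {φ ψ : Path G v w} (h : φ.toPathMap = ψ.toPathMap) : φ = ψ := by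
  cases φ; cases ψ; cases h; rfl

/-- Concatenation. -/
def trans (φ : Path G v w) (ψ : Path G w x) : Path G v x where
  toPathMap := φ.toPathMap.concat ψ.toPathMap (φ.target_eq.trans ψ.source_eq.symm)
  source_eq := by rw [PathMap.source_concat, φ.source_eq]
  target_eq := by rw [PathMap.target_concat, ψ.target_eq]

/-- The inverse path. -/
def symm (φ : Path G v w) : Path G w v where
  toPathMap := φ.toPathMap.reverse
  source_eq := by rw [PathMap.source_reverse, φ.target_eq]
  target_eq := by rw [PathMap.target_reverse, φ.source_eq]

/-- The constant path of length zero. -/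
def refl (G : Digraph V) (v : V) : Path G v v := ⟨PathMap.const G v, rfl, rfl⟩

/-- The path along an edge. -/
def edge (h : EqOrAdj G v w) : Path G v w := ⟨PathMap.edge h, rfl, rfl⟩

/-- A closed path as a loop. -/
def toLoop (φ : Path G v v) : Loop G v := ⟨φ.toPathMap, φ.source_eq, φ.target_eq⟩

/-- A loop as a closed path. -/
def ofLoop (φ : Loop G v) : Path G v v := ⟨φ.toPathMap, φ.source_eq, φ.target_eq⟩

theorem trans_assoc (φ : Path G v w) (ψ : Path G w x) (χ : Path G x y) :
    (φ.trans ψ).trans χ = φ.trans (ψ.trans χ) :=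
  ext_toPathMap (PathMap.concat_assoc _ _ _ (φ.target_eq.trans ψ.source_eq.symm)
    ((φ.trans ψ).target_eq.trans χ.source_eq.symm) (ψ.target_eq.trans χ.source_eq.symm)
    (φ.target_eq.trans (ψ.trans χ).source_eq.symm))

theorem symm_symm (φ : Path G v w) : φ.symm.symm = φ := ext_toPathMap (PathMap.reverse_reverse _)

theorem trans_refl (φ : Path G v w) : φ.trans (refl G w) = φ :=
  ext_toPathMap (PathMap.concat_const _ _ φ.target_eq)

/-- `foldLoop` needs a loop, but it only uses the first `k` edges. Folding the loop `φ φ⁻¹` at `k =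
φ.length` therefore retracts a path `φ` that need not be closed. -/
theorem trans_symm_chomotopic (φ : Path G v w) :
    CHomotopic (φ.trans φ.symm).toLoop (Loop.trivial G v) := by
  refine .trans _ _ _ (CHomotopic.of_oneStep (oneStep_of_eq ?_ ?_ ?_))
    (foldLoop_chomotopic (φ.trans φ.symm).toLoop φ.length)
  · change φ.length + φ.length = 2 * φ.length
    omega
  · intro i hi
    change i ≤ φ.length + φ.length at hi
    simp only [foldLoop, toLoop, trans, symm]
    rw [PathMap.vert_ofNat (by omega)]
    split_ifs with h
    · rfl
    · rw [PathMap.vert_concat, PathMap.vert_concat, if_neg h, if_pos (by omega),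
        PathMap.vert_reverse _ (by omega)]
      congr 1
      omega
  · intro i hi
    change i < φ.length + φ.length at hi
    simp only [foldLoop, toLoop, trans, symm]
    rw [PathMap.dir_ofNat (by omega)]
    split_ifs with h
    · rfl
    · rw [PathMap.dir_concat, PathMap.dir_concat, if_neg h, if_pos (by omega),
        PathMap.dir_reverse _ (by omega)]
      congr 2
      omega

/-- The class of a closed path at the base vertex. -/
def cls (φ : Path G b b) : FundamentalGroup G b := Quotient.mk (loopSetoid G b) φ.toLoop

theorem cls_trans (φ ψ : Path G b b) : (φ.trans ψ).cls = φ.cls * ψ.cls := rfl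

theorem cls_eq_of_oneStep (α : Path G b v) (β : Path G w b) {φ ψ : Path G v w}
    (h : OneStep φ.toPathMap ψ.toPathMap) :
    ((α.trans φ).trans β).cls = ((α.trans ψ).trans β).cls :=
  Quotient.sound (CHomotopic.of_oneStep (oneStep_concat_left
    ((α.trans φ).target_eq.trans β.source_eq.symm) ((α.trans ψ).target_eq.trans β.source_eq.symm)
    (oneStep_concat_right (α.target_eq.trans φ.source_eq.symm)
      (α.target_eq.trans ψ.source_eq.symm) h)))

/-- Change of base vertex: a homotopy of loops at `v` remains a homotopy when every loop in it is
extended by `α` and `β`. -/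
theorem cls_eq_of_chomotopic (α : Path G b v) (β : Path G v b) {φ ψ : Loop G v}
    (h : CHomotopic φ ψ) :
    ((α.trans (ofLoop φ)).trans β).cls = ((α.trans (ofLoop ψ)).trans β).cls := by
  induction h with
  | rel φ ψ h =>
    rcases h.2 with h | h
    · exact cls_eq_of_oneStep α β (φ := ofLoop φ) (ψ := ofLoop ψ) (Or.inl h)
    · exact (cls_eq_of_oneStep α β (φ := ofLoop ψ) (ψ := ofLoop φ) (Or.inr h)).symm
  | refl => rfl
  | symm _ _ _ ih => exact ih.symm
  | trans _ _ _ _ _ ih1 ih2 => exact ih1.trans ih2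

theorem cls_cancel (α : Path G b v) (φ : Path G v w) (β : Path G v b) :
    ((α.trans (φ.trans φ.symm)).trans β).cls = (α.trans β).cls := by
  have := cls_eq_of_chomotopic α β (trans_symm_chomotopic φ)
  change _ = ((α.trans (refl G v)).trans β).cls at this
  rwa [trans_refl] at this

/-! ### The functor from paths to the fundamental group given by paths from the base vertex. -/

section BasedClass

variable (p : ∀ v, Path G b v)

/-- The class of a path, closed up by a chosen system of paths from the base vertex. -/
def basedClass (φ : Path G v w) : FundamentalGroup G b := (((p v).trans φ).trans (p w).symm).cls

theorem basedClass_trans (φ : Path G v w) (ψ : Path G w x) :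
    basedClass p (φ.trans ψ) = basedClass p φ * basedClass p ψ := by
  -- The product on the right contains `(p w)⁻¹ · p w` between `φ` and `ψ`, and this backtracking
  -- cancels.
  have := cls_cancel ((p v).trans φ) (p w).symm (ψ.trans (p x).symm)
  rw [symm_symm] at this
  simp only [basedClass, ← cls_trans]
  simp only [trans_assoc] at this ⊢
  exact this.symm

/-- The constant path is strictly idempotent, and the only idempotent of a group is `1`. -/
theorem basedClass_refl (v : V) : basedClass p (refl G v) = 1 := by
  have := basedClass_trans p (refl G v) (refl G v)
  rw [trans_refl] at this
  exact left_eq_mul.1 this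

theorem basedClass_symm (φ : Path G v w) : basedClass p φ.symm = (basedClass p φ)⁻¹ := by
  refine eq_inv_of_mul_eq_one_right ?_
  rw [← basedClass_trans, ← basedClass_refl p v]
  exact cls_eq_of_chomotopic (p v) (p v).symm (trans_symm_chomotopic φ)

theorem basedClass_eq_of_oneStep {φ ψ : Path G v w} (h : OneStep φ.toPathMap ψ.toPathMap) :
    basedClass p φ = basedClass p ψ := cls_eq_of_oneStep _ _ h

theorem basedClass_edge_self (h : EqOrAdj G v v) : basedClass p (edge h) = 1 := by
  rw [← basedClass_refl p v]
  -- The shrinking map collapses the degenerate edge onto the single vertex of the constant path.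
  refine basedClass_eq_of_oneStep p (Or.inl (oneStepDirect_iff.2 ⟨fun _ => 0,
    ⟨rfl, rfl, fun _ _ => Or.inl rfl⟩, fun i _ => Or.inl ?_⟩))
  change (PathMap.edge h).vert i = v
  rw [PathMap.vert_edge, ite_self]

theorem basedClass_square {a c d e : V} (hac : EqOrAdj G a c) (hce : EqOrAdj G c e)
    (had : EqOrAdj G a d) (hde : EqOrAdj G d e) :
    basedClass p (edge hac) * basedClass p (edge hce) =
      basedClass p (edge had) * basedClass p (edge hde) := by
  -- Degenerate edges pad the two sides to `a, a, c, e` and `a, d, e, e`. The columns are then `a =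
  -- a`, `a → d`, `c → e`, `e = e` (up to equality of vertices), so the identity shrinking map gives
  -- a direct homotopy.
  have key : basedClass p (((edge (EqOrAdj.refl G a)).trans (edge hac)).trans (edge hce)) =
      basedClass p (((edge had).trans (edge hde)).trans (edge (EqOrAdj.refl G e))) := by
    refine basedClass_eq_of_oneStep p (oneStep_of_eqOrAdj rfl ?_ ?_)
    · intro i hi
      change i ≤ 3 at hi
      simp only [trans, edge, PathMap.vert_concat, PathMap.length_concat, PathMap.length_edge,
        PathMap.vert_edge]
      interval_cases i <;> simp [EqOrAdj.refl, *]
    · intro i _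
      simp only [trans, edge, PathMap.dir_concat, PathMap.dir_edge, ite_self]
  simpa only [basedClass_trans, basedClass_edge_self, one_mul, mul_one] using key

/-- The chosen path `p b` may be a nontrivial loop. Closing up with it conjugates by its class,
which is invisible in the abelianization. -/
theorem of_basedClass_ofLoop (φ : Loop G b) :
    Abelianization.of (basedClass p (ofLoop φ)) =
      Abelianization.of (ofLoop φ).cls := by
  change Abelianization.of ((p b).cls * (ofLoop φ).cls * (p b).cls⁻¹) = _
  rw [map_mul, map_mul, map_inv, mul_inv_cancel_comm]

end BasedClass

end Path

/-! ### Sums along path-maps -/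

section PathSum

variable {A : Type*} [AddCommGroup A]

namespace PathMap

/-- The contribution of the `i`-th edge to the sum of `F` along a path-map. -/
def edgeTerm (F : V → V → A) (φ : PathMap G) (i : ℕ) : A :=
  if φ.dir i = true then F (φ.vert i) (φ.vert (i + 1)) else -F (φ.vert (i + 1)) (φ.vert i)

/-- The signed sum of `F` over the edges of a path-map. -/
def pathSum (F : V → V → A) (φ : PathMap G) : A := ∑ i ∈ Finset.range φ.length, edgeTerm F φ i

theorem edgeTerm_congr (F : V → V → A) {φ ψ : PathMap G} {i j : ℕ} (hd : φ.dir i = ψ.dir j)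
    (h0 : φ.vert i = ψ.vert j) (h1 : φ.vert (i + 1) = ψ.vert (j + 1)) :
    edgeTerm F φ i = edgeTerm F ψ j := by
  simp only [edgeTerm, hd, h0, h1]

theorem edgeTerm_take (F : V → V → A) (φ : PathMap G) {i k : ℕ} (hi : i < k) :
    edgeTerm F (φ.take k) i = edgeTerm F φ i :=
  edgeTerm_congr F (dir_take φ hi) (vert_take φ hi.le) (vert_take φ hi)

theorem pathSum_take (F : V → V → A) (φ : PathMap G) (k : ℕ) :
    pathSum F (φ.take k) = ∑ i ∈ Finset.range k, edgeTerm F φ i :=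
  Finset.sum_congr rfl fun _ hi => edgeTerm_take F φ (Finset.mem_range.1 hi)

theorem pathSum_concat (F : V → V → A) (φ ψ : PathMap G) (h) :
    pathSum F (φ.concat ψ h) = pathSum F φ + pathSum F ψ := by
  rw [pathSum, length_concat, Finset.sum_range_add]
  congr 1
  · refine Finset.sum_congr rfl fun i hi => ?_
    rw [Finset.mem_range] at hi
    exact edgeTerm_congr F (by rw [dir_concat, if_pos hi]) (by rw [vert_concat, if_pos hi.le])
      (by rw [vert_concat, if_pos (Nat.succ_le_of_lt hi)])
  · refine Finset.sum_congr rfl fun i _ => ?_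
    refine edgeTerm_congr F ?_ ?_ ?_
    · rw [dir_concat, if_neg (by omega), Nat.add_sub_cancel_left]
    · rw [vert_concat]
      split_ifs with hi
      · obtain rfl : i = 0 := by omega
        rw [Nat.add_zero, vert_of_le _ le_rfl, h, vert_zero]
      · rw [Nat.add_sub_cancel_left]
    · rw [vert_concat, if_neg (by omega), Nat.add_assoc, Nat.add_sub_cancel_left]

theorem pathSum_reverse (F : V → V → A) (φ : PathMap G) :
    pathSum F φ.reverse = -pathSum F φ := by
  rw [pathSum, pathSum, length_reverse, ← Finset.sum_range_reflect, ← Finset.sum_neg_distrib]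
  refine Finset.sum_congr rfl fun i hi => ?_
  rw [Finset.mem_range] at hi
  rw [edgeTerm, edgeTerm, dir_reverse _ (by omega), vert_reverse _ (by omega),
    vert_reverse _ (by omega), show φ.length - 1 - (φ.length - 1 - i) = i by omega,
    show φ.length - (φ.length - 1 - i) = i + 1 by omega,
    show φ.length - (φ.length - 1 - i + 1) = i by omega]
  cases φ.dir i <;> simp

theorem pathSum_edge (F : V → V → A) {a c : V} (h : EqOrAdj G a c) :
    pathSum F (edge h) = F a c := by
  simp [pathSum, length_edge, edgeTerm, dir_edge, vert_edge]

theorem pathSum_const (F : V → V → A) (a : V) : pathSum F (const G a) = 0 := rfl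

theorem map_pathSum {B : Type*} [AddCommGroup B] (f : A →+ B) (F : V → V → A) (φ : PathMap G) :
    f (pathSum F φ) = pathSum (fun a c => f (F a c)) φ := by
  rw [pathSum, map_sum]
  refine Finset.sum_congr rfl fun i _ => ?_
  simp only [edgeTerm, apply_ite f, map_neg]

end PathMap

namespace Path

variable {v w x : V} (F : V → V → A)

theorem pathSum_trans (φ : Path G v w) (ψ : Path G w x) :
    (φ.trans ψ).pathSum F = φ.pathSum F + ψ.pathSum F :=
  PathMap.pathSum_concat F _ _ (φ.target_eq.trans ψ.source_eq.symm)

theorem pathSum_symm (φ : Path G v w) : φ.symm.pathSum F = -φ.pathSum F :=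
  PathMap.pathSum_reverse F _

theorem pathSum_edge (h : EqOrAdj G v w) : (edge h).pathSum F = F v w := PathMap.pathSum_edge F h

end Path

/-- `F` vanishes on the diagonal and takes the same value on both sides of every, possibly
degenerate, commutative square. -/
structure IsSquareInvariant (G : Digraph V) (F : V → V → A) : Prop where
  diag : ∀ a, F a a = 0
  square : ∀ {a c d e}, EqOrAdj G a c → EqOrAdj G c e → EqOrAdj G a d → EqOrAdj G d e →
    F a c + F c e = F a d + F d e

/-- A discrete Stokes argument on the ladder between `φ` and `ψ`. The partial sum of `φ` up to `i`
and that of `ψ` up to `h i` differ by `F` on the rung at `i`; each step adds one cell. The last rung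
is degenerate because the targets agree, so its contribution vanishes. -/
theorem IsSquareInvariant.pathSum_eq {F : V → V → A} (hF : IsSquareInvariant G F)
    {φ ψ : PathMap G} (hs : φ.source = ψ.source) (ht : φ.target = ψ.target) (H : OneStep φ ψ) :
    φ.pathSum F = ψ.pathSum F := by
  rcases H with H | H
  · obtain ⟨h, hh, hv⟩ := oneStepDirect_iff.1 H
    have key : ∀ i ≤ φ.length, (∑ j ∈ Finset.range i, φ.edgeTerm F j) +
        F (φ.vert i) (ψ.vert (h i)) = ∑ j ∈ Finset.range (h i), ψ.edgeTerm F j := by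
      intro i hi
      induction i with
      | zero => simp [hh.zero, PathMap.vert_zero, hs, hF.diag]
      | succ i ih =>
        have ih := ih (by omega)
        have hst := φ.step i
        have h0 := hv i (by omega)
        have h1 := hv (i + 1) hi
        rw [Finset.sum_range_succ, PathMap.edgeTerm]
        rcases hh.step i hi with e | ⟨e, hlt, hd⟩
        -- Here `h` stays put and the cell is a triangle, treated as a square with one side
        -- constant.
        · rw [e] at h1 ⊢
          rw [← ih]
          cases hφ : φ.dir i
          · have := hF.square (hst.2 hφ) h0 h1 (EqOrAdj.refl _ _)
            rw [hF.diag, add_zero] at this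
            rw [if_neg Bool.false_ne_true, ← this]
            abel
          · have := hF.square (hst.1 hφ) h1 h0 (EqOrAdj.refl _ _)
            rw [hF.diag, add_zero] at this
            rw [if_pos rfl, ← this]
            abel
        · have hst' := ψ.step (h i)
          rw [e] at h1 ⊢
          rw [Finset.sum_range_succ, ← ih, PathMap.edgeTerm, hd]
          rw [hd] at hst'
          cases hφ : φ.dir i
          · have := hF.square (hst.2 hφ) h0 h1 (hst'.2 hφ)
            rw [if_neg Bool.false_ne_true, if_neg Bool.false_ne_true]
            -- Both parallel edges are traversed backwards, so the goal is the negative of the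
            -- square relation.
            rw [← sub_eq_zero] at this ⊢
            rw [← neg_eq_zero, ← this]
            abel
          · have := hF.square (hst.1 hφ) h1 h0 (hst'.1 hφ)
            rw [if_pos rfl, if_pos rfl, add_assoc, this, add_assoc]
    have := key φ.length le_rfl
    rwa [hh.last, PathMap.vert_of_le _ le_rfl, PathMap.vert_of_le _ le_rfl, ht, hF.diag,
      add_zero] at this
  · obtain ⟨h, hh, hv⟩ := oneStepInverse_iff.1 H
    have key : ∀ i ≤ φ.length, (∑ j ∈ Finset.range i, φ.edgeTerm F j) =
        (∑ j ∈ Finset.range (h i), ψ.edgeTerm F j) + F (ψ.vert (h i)) (φ.vert i) := by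
      intro i hi
      induction i with
      | zero => simp [hh.zero, PathMap.vert_zero, hs, hF.diag]
      | succ i ih =>
        have ih := ih (by omega)
        have hst := φ.step i
        have h0 := hv i (by omega)
        have h1 := hv (i + 1) hi
        rw [Finset.sum_range_succ, PathMap.edgeTerm, ih]
        rcases hh.step i hi with e | ⟨e, hlt, hd⟩
        · rw [e] at h1 ⊢
          cases hφ : φ.dir i
          · have := hF.square h1 (hst.2 hφ) (EqOrAdj.refl _ _) h0
            rw [hF.diag, zero_add] at this
            rw [if_neg Bool.false_ne_true, ← this]
            abel
          · have := hF.square h0 (hst.1 hφ) (EqOrAdj.refl _ _) h1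
            rw [hF.diag, zero_add] at this
            rw [if_pos rfl, ← this]
            abel
        · have hst' := ψ.step (h i)
          rw [e] at h1 ⊢
          rw [Finset.sum_range_succ, PathMap.edgeTerm, hd]
          rw [hd] at hst'
          cases hφ : φ.dir i
          · have := hF.square h1 (hst.2 hφ) (hst'.2 hφ) h0
            rw [if_neg Bool.false_ne_true, if_neg Bool.false_ne_true]
            rw [← sub_eq_zero] at this ⊢
            rw [← neg_eq_zero, ← this]
            abel
          · have := hF.square h0 (hst.1 hφ) (hst'.1 hφ) h1
            rw [if_pos rfl, if_pos rfl, add_assoc, this, add_assoc]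
    have := key φ.length le_rfl
    rwa [hh.last, PathMap.vert_of_le _ le_rfl, PathMap.vert_of_le _ le_rfl, ht, hF.diag,
      add_zero] at this

theorem IsSquareInvariant.pathSum_eq_of_chomotopic {F : V → V → A} (hF : IsSquareInvariant G F)
    {φ ψ : Loop G b} (H : CHomotopic φ ψ) : φ.pathSum F = ψ.pathSum F := by
  have key : ∀ φ ψ : Loop G b, OneStep φ.toPathMap ψ.toPathMap → φ.pathSum F = ψ.pathSum F :=
    fun φ ψ h => hF.pathSum_eq (φ.source_eq.trans ψ.source_eq.symm)
      (φ.target_eq.trans ψ.target_eq.symm) h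
  induction H with
  | rel φ ψ h => exact h.2.elim (fun h => key _ _ (Or.inl h)) (fun h => (key _ _ (Or.inr h)).symm)
  | refl => rfl
  | symm _ _ _ ih => exact ih.symm
  | trans _ _ _ _ _ ih1 ih2 => exact ih1.trans ih2

end PathSum

/-! ### Elementary paths in low degrees -/

section Elementary

variable (K : Type v) [CommRing K]

/-- The elementary `1`-path `e_{ac}`. -/
noncomputable def elemEdge (a c : V) : RegularPaths K V 1 := elem K ![a, c]

variable {K}

theorem elem_eq_zero {p : ℕ} {i : Fin (p + 1) → V} (h : ¬ IsRegularPath i) : elem K i = 0 :=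
  dif_neg h

theorem elem_eq_single {p : ℕ} {i : Fin (p + 1) → V} (h : IsRegularPath i) :
    elem K i = Finsupp.single ⟨i, h⟩ 1 := dif_pos h

theorem elemEdge_self (a : V) : elemEdge K a a = 0 := elem_eq_zero fun h => h 0 rfl

theorem elem_eq_elemEdge (i : Fin 2 → V) : elem K (p := 1) i = elemEdge K (i 0) (i 1) := by
  rw [elemEdge]
  congr 1
  funext k
  fin_cases k <;> rfl

theorem boundary_elem {p : ℕ} {i : Fin (p + 1 + 1) → V} (h : IsRegularPath i) :
    boundary K V p (elem K i) = ∑ q : Fin (p + 2), (-1 : K) ^ (q : ℕ) • elem K (q.removeNth i) := by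
  rw [elem_eq_single h, boundary, Finsupp.linearCombination_single, one_smul]

theorem boundary_elemEdge (a c : V) :
    boundary K V 0 (elemEdge K a c) = elem K ![c] - elem K ![a] := by
  have e0 : (0 : Fin 2).removeNth ![a, c] = ![c] := by funext k; fin_cases k; rfl
  have e1 : (1 : Fin 2).removeNth ![a, c] = ![a] := by funext k; fin_cases k; rfl
  by_cases h : a = c
  · rw [h, elemEdge_self, map_zero, sub_self]
  · rw [elemEdge, boundary_elem (fun k => by fin_cases k; exact h), Fin.sum_univ_two, e0, e1]
    simp [sub_eq_add_neg]

/-- Regularity is not needed: if `a = c` or `c = d`, the left side is zero and the right side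
cancels. Degenerate squares thus need no separate treatment. -/
theorem boundary_elem_two (a c d : V) :
    boundary K V 1 (elem K ![a, c, d]) = elemEdge K c d - elemEdge K a d + elemEdge K a c := by
  have e0 : (0 : Fin 3).removeNth ![a, c, d] = ![c, d] := by funext k; fin_cases k <;> rfl
  have e1 : (1 : Fin 3).removeNth ![a, c, d] = ![a, d] := by funext k; fin_cases k <;> rfl
  have e2 : (2 : Fin 3).removeNth ![a, c, d] = ![a, c] := by funext k; fin_cases k <;> rfl
  by_cases h : a = c
  · subst h
    rw [elem_eq_zero fun h => h 0 rfl, map_zero, elemEdge_self, add_zero, sub_self]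
  by_cases h' : c = d
  · subst h'
    rw [elem_eq_zero fun h => h 1 rfl, map_zero, elemEdge_self, zero_sub, neg_add_cancel]
  rw [boundary_elem (fun k => by fin_cases k; exacts [h, h']), Fin.sum_univ_three, e0, e1, e2]
  simp [elemEdge, sub_eq_add_neg]

theorem elemEdge_mem_allowedPaths {a c : V} (h : EqOrAdj G a c) :
    elemEdge K a c ∈ allowedPaths K G 1 := by
  rcases h with rfl | h
  · rw [elemEdge_self]
    exact zero_mem _
  · exact Submodule.subset_span ⟨![a, c], fun k => by fin_cases k; exact h, rfl⟩

theorem elem_two_mem_allowedPaths {a c d : V} (h : EqOrAdj G a c) (h' : EqOrAdj G c d) :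
    elem K ![a, c, d] ∈ allowedPaths K G 2 := by
  rcases h with rfl | h
  · rw [elem_eq_zero fun h => h 0 rfl]
    exact zero_mem _
  rcases h' with rfl | h'
  · rw [elem_eq_zero fun h => h 1 rfl]
    exact zero_mem _
  · exact Submodule.subset_span ⟨![a, c, d], fun k => by fin_cases k; exacts [h, h'], rfl⟩

/-- Adjacency along a `0`-path is an empty condition. Consequently `Ω_1` is all of `A_1`. -/
theorem mem_allowedPaths_zero (x : RegularPaths K V 0) : x ∈ allowedPaths K G 0 := by
  induction x using Finsupp.induction_linear with
  | zero => exact zero_mem _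
  | add x y hx hy => exact add_mem hx hy
  | single i r =>
    rw [← mul_one r, ← smul_eq_mul, ← Finsupp.smul_single]
    exact Submodule.smul_mem _ _ (Submodule.subset_span
      ⟨i.1, fun k => k.elim0, (elem_eq_single i.2).symm⟩)

variable (K G) in
-- The values lie in `R_1` modulo boundaries rather than in homology, since a single edge is not a
-- cycle in general.
theorem isSquareInvariant_mkQ_elemEdge :
    IsSquareInvariant G fun a c => (boundaries K G 1).mkQ (elemEdge K a c) where
  diag a := by rw [elemEdge_self, map_zero]
  square {a c d e} hac hce had hde := by
    rw [← map_add, ← map_add, Submodule.mkQ_apply, Submodule.mkQ_apply, Submodule.Quotient.eq]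
    -- The diagonal term `e_{ae}`, which need not be allowed, cancels in the difference; only the
    -- four sides remain.
    have hbd : boundary K V 1 (elem K ![a, c, e] - elem K ![a, d, e]) =
        elemEdge K a c + elemEdge K c e - (elemEdge K a d + elemEdge K d e) := by
      rw [map_sub, boundary_elem_two, boundary_elem_two]
      abel
    refine ⟨elem K ![a, c, e] - elem K ![a, d, e], ⟨sub_mem (elem_two_mem_allowedPaths hac hce)
      (elem_two_mem_allowedPaths had hde), ?_⟩, hbd⟩
    rw [SetLike.mem_coe, Submodule.mem_comap, hbd]
    exact sub_mem (add_mem (elemEdge_mem_allowedPaths hac) (elemEdge_mem_allowedPaths hce))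
      (add_mem (elemEdge_mem_allowedPaths had) (elemEdge_mem_allowedPaths hde))

/-! ### The cycle of a loop and the Hurewicz homomorphism. -/

theorem edgeTerm_elemEdge_mem (φ : PathMap G) (i : ℕ) :
    φ.edgeTerm (elemEdge K) i ∈ allowedPaths K G 1 := by
  have h := φ.step i
  rw [PathMap.edgeTerm]
  split_ifs with hd
  · exact elemEdge_mem_allowedPaths (h.1 hd)
  · exact neg_mem (elemEdge_mem_allowedPaths (h.2 (by simpa using hd)))

theorem boundary_pathSum_take (φ : PathMap G) (k : ℕ) :
    boundary K V 0 ((φ.take k).pathSum (elemEdge K)) =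
      elem K ![φ.vert k] - elem K ![φ.source] := by
  induction k with
  | zero => rw [φ.vert_zero, sub_self, φ.take_zero, PathMap.pathSum_const, map_zero]
  | succ k ih =>
    rw [PathMap.pathSum_take] at ih ⊢
    rw [Finset.sum_range_succ, map_add, ih, PathMap.edgeTerm]
    split_ifs
    · rw [boundary_elemEdge]
      abel
    · rw [map_neg, boundary_elemEdge]
      abel

variable (K) in
/-- The `1`-cycle of a loop. -/
noncomputable def Loop.cycle (φ : Loop G b) : cycles K G 1 :=
  ⟨φ.pathSum (elemEdge K), ⟨Submodule.sum_mem _ fun i _ => edgeTerm_elemEdge_mem _ i,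
    mem_allowedPaths_zero _⟩, by
    have := boundary_pathSum_take (K := K) φ.toPathMap φ.length
    rwa [PathMap.take_length, PathMap.vert_of_le _ le_rfl, φ.source_eq, φ.target_eq,
      sub_self] at this⟩

variable (K) in
/-- The homology class of a loop. -/
noncomputable def Loop.homologyClass (φ : Loop G b) : PathHomology K G 1 :=
  Submodule.Quotient.mk (φ.cycle K)

theorem Loop.homologyClass_eq_of_chomotopic {φ ψ : Loop G b} (h : CHomotopic φ ψ) :
    φ.homologyClass K = ψ.homologyClass K := by
  have := (isSquareInvariant_mkQ_elemEdge G K).pathSum_eq_of_chomotopic h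
  have e : ∀ φ : Loop G b,
      φ.pathSum (fun a c => (boundaries K G 1).mkQ (elemEdge K a c)) =
        (boundaries K G 1).mkQ (φ.pathSum (elemEdge K)) := fun φ =>
    (PathMap.map_pathSum (boundaries K G 1).mkQ.toAddMonoidHom (elemEdge K) φ.toPathMap).symm
  rw [e, e] at this
  -- Both quotients test whether the same difference of `1`-paths lies in `∂Ω_2`.
  exact (Submodule.Quotient.eq _).2 ((Submodule.Quotient.eq (boundaries K G 1)).1 this)

theorem Loop.homologyClass_concat (φ ψ : Loop G b) :
    (φ.concat ψ).homologyClass K = φ.homologyClass K + ψ.homologyClass K :=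
  congrArg Submodule.Quotient.mk (Subtype.ext (PathMap.pathSum_concat _ _ _
    (φ.target_eq.trans ψ.source_eq.symm)) : (φ.concat ψ).cycle K = φ.cycle K + ψ.cycle K)

variable (K G b) in
/-- The Hurewicz homomorphism. -/
noncomputable def hurewicz :
    Additive (Abelianization (FundamentalGroup G b)) →+ PathHomology K G 1 :=
  MonoidHom.toAdditiveLeft (Abelianization.lift
    { toFun := Quotient.lift
        (fun φ : Loop G b => Multiplicative.ofAdd (φ.homologyClass K))
        fun _ _ h => congrArg _ (Loop.homologyClass_eq_of_chomotopic h)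
      map_one' := rfl
      map_mul' := by
        rintro ⟨φ⟩ ⟨ψ⟩
        exact congrArg Multiplicative.ofAdd (Loop.homologyClass_concat φ ψ) })

end Elementary

/-! ### The inverse of the Hurewicz homomorphism -/

section Inverse

variable (p : ∀ v, Path G b v)

namespace Path

variable {v w : V}

/-- The class of a based path in the abelianized fundamental group. -/
def abClass (φ : Path G v w) : Additive (Abelianization (FundamentalGroup G b)) :=
  Additive.ofMul (Abelianization.of (basedClass p φ))

/-- Compares paths with the same underlying path-map whose end vertices are equal only
propositionally. -/
theorem abClass_congr {v' w' : V} {φ : Path G v w} {ψ : Path G v' w'}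
    (h : φ.toPathMap = ψ.toPathMap) : abClass p φ = abClass p ψ := by
  obtain ⟨φ, rfl, rfl⟩ := φ
  obtain ⟨ψ, rfl, rfl⟩ := ψ
  obtain rfl : φ = ψ := h
  rfl

theorem abClass_trans {x : V} (φ : Path G v w) (ψ : Path G w x) :
    abClass p (φ.trans ψ) = abClass p φ + abClass p ψ := by
  simp only [abClass, basedClass_trans, map_mul, ofMul_mul]

theorem abClass_symm (φ : Path G v w) : abClass p φ.symm = -abClass p φ := by
  simp only [abClass, basedClass_symm, map_inv, ofMul_inv]

theorem abClass_refl (v : V) : abClass p (refl G v) = 0 := by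
  simp only [abClass, basedClass_refl, map_one, ofMul_one]

theorem abClass_edge_self (h : EqOrAdj G v v) : abClass p (edge h) = 0 := by
  simp only [abClass, basedClass_edge_self, map_one, ofMul_one]

theorem abClass_square {a c d e : V} (hac : EqOrAdj G a c) (hce : EqOrAdj G c e)
    (had : EqOrAdj G a d) (hde : EqOrAdj G d e) :
    abClass p (edge hac) + abClass p (edge hce) = abClass p (edge had) + abClass p (edge hde) := by
  simp only [abClass, ← ofMul_mul, ← map_mul, basedClass_square p hac hce had hde]

end Path

open Classical in
/-- The class of any two-step directed path from `a` to `e`, zero if there is none. -/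
noncomputable def diagClass (a e : V) : Additive (Abelianization (FundamentalGroup G b)) :=
  if h : ∃ c, EqOrAdj G a c ∧ EqOrAdj G c e then
    Path.abClass p (Path.edge h.choose_spec.1) + Path.abClass p (Path.edge h.choose_spec.2)
  else 0

theorem diagClass_eq {a c e : V} (hac : EqOrAdj G a c) (hce : EqOrAdj G c e) :
    diagClass p a e = Path.abClass p (Path.edge hac) + Path.abClass p (Path.edge hce) := by
  rw [diagClass, dif_pos ⟨c, hac, hce⟩]
  exact Path.abClass_square p _ _ _ _

/-- An edge is also a two-step path with constant first step, so `diagClass` extends the function on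
edges. -/
theorem diagClass_edge {a c : V} (h : EqOrAdj G a c) :
    diagClass p a c = Path.abClass p (Path.edge h) := by
  rw [diagClass_eq p (EqOrAdj.refl G a) h, Path.abClass_edge_self, zero_add]

theorem diagClass_self (a : V) : diagClass p a a = 0 := by
  rw [diagClass_edge p (EqOrAdj.refl G a), Path.abClass_edge_self]

theorem abClass_take (φ : PathMap G) (k : ℕ) :
    Path.abClass p (⟨φ.take k, φ.source_take k, φ.target_take k⟩ : Path G φ.source (φ.vert k)) =
      (φ.take k).pathSum (diagClass p) := by
  induction k with
  | zero =>
    exact (Path.abClass_congr p φ.take_zero).trans (Path.abClass_refl p φ.source)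
  | succ k ih =>
    rw [PathMap.pathSum_take, Finset.sum_range_succ, ← PathMap.pathSum_take, ← ih,
      PathMap.edgeTerm]
    split_ifs with hd
    · rw [diagClass_edge p ((φ.step k).1 hd), ← Path.abClass_trans]
      congr 1
      exact Path.ext_toPathMap (φ.take_succ_of_true k hd rfl)
    · have hd' : φ.dir k = false := by simpa using hd
      rw [diagClass_edge p ((φ.step k).2 hd'), ← Path.abClass_symm, ← Path.abClass_trans]
      congr 1
      exact Path.ext_toPathMap (φ.take_succ_of_false k hd' rfl)

theorem abClass_eq_pathSum {v w : V} (φ : Path G v w) :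
    Path.abClass p φ = φ.pathSum (diagClass p) := by
  have := abClass_take p φ.toPathMap φ.length
  refine (Path.abClass_congr p φ.take_length.symm).trans (this.trans ?_)
  rw [φ.take_length]

/-- The linear extension of `diagClass`. -/
noncomputable def diagLift :
    RegularPaths ℤ V 1 →ₗ[ℤ] Additive (Abelianization (FundamentalGroup G b)) :=
  Finsupp.linearCombination ℤ fun i => diagClass p (i.1 0) (i.1 1)

theorem diagLift_elemEdge (a c : V) : diagLift p (elemEdge ℤ a c) = diagClass p a c := by
  by_cases h : a = c
  · rw [h, elemEdge_self, map_zero, diagClass_self]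
  · rw [elemEdge, elem_eq_single (fun k => by fin_cases k; exact h), diagLift,
      Finsupp.linearCombination_single, one_smul]
    rfl

/-- It suffices to treat a single allowed path `e_{ace}`: the value of `diagClass` at `(a, e)` can
be computed through `c`, and the three terms of the boundary cancel. -/
theorem diagLift_boundary {x : RegularPaths ℤ V 2} (hx : x ∈ allowedPaths ℤ G 2) :
    diagLift p (boundary ℤ V 1 x) = 0 := by
  induction hx using Submodule.span_induction with
  | zero => rw [map_zero, map_zero]
  | add x y _ _ hx hy => rw [map_add, map_add, hx, hy, add_zero]
  | smul r x _ hx => rw [map_smul, map_smul, hx, smul_zero]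
  | mem x hx =>
    obtain ⟨i, hi, rfl⟩ := hx
    have e : i = ![i 0, i 1, i 2] := by funext k; fin_cases k <;> rfl
    have h0 : EqOrAdj G (i 0) (i 1) := Or.inr (hi 0)
    have h1 : EqOrAdj G (i 1) (i 2) := Or.inr (hi 1)
    rw [e, boundary_elem_two, map_add, map_sub, diagLift_elemEdge, diagLift_elemEdge,
      diagLift_elemEdge, diagClass_eq p h0 h1, diagClass_edge p h0, diagClass_edge p h1]
    abel

/-- The homomorphism from the first homology to the abelianized fundamental group that sends the
class of an edge to the class of the loop through this edge. -/
noncomputable def hurewiczInv :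
    PathHomology ℤ G 1 →ₗ[ℤ] Additive (Abelianization (FundamentalGroup G b)) :=
  Submodule.liftQ _ ((diagLift p).comp (cycles ℤ G 1).subtype) (by
    rintro ⟨x, _⟩ ⟨y, hy, h⟩
    change diagLift p x = 0
    change _ = x at h
    rw [← h]
    exact diagLift_boundary p hy.1)

theorem hurewiczInv_hurewicz (x : Additive (Abelianization (FundamentalGroup G b))) :
    hurewiczInv p (hurewicz G b ℤ x) = x := by
  obtain ⟨g, rfl⟩ := Additive.ofMul.surjective x
  obtain ⟨g, rfl⟩ := QuotientGroup.mk_surjective g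
  obtain ⟨φ, rfl⟩ := Quotient.exists_rep g
  change diagLift p (φ.pathSum (elemEdge ℤ)) = Additive.ofMul (Abelianization.of (Path.ofLoop φ).cls)
  -- Replacing the loop by its closed-up class makes it a sum of edge classes, to be matched with
  -- `diagLift` term by term.
  rw [← Path.of_basedClass_ofLoop p]
  refine Eq.trans ?_ (abClass_eq_pathSum p (Path.ofLoop φ)).symm
  refine (PathMap.map_pathSum (diagLift p).toAddMonoidHom _ _).trans ?_
  congr 1
  funext a c
  exact diagLift_elemEdge p a c

/-- The linear map that sends a vertex to the `1`-path of the chosen path to this vertex. -/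
noncomputable def cone : RegularPaths ℤ V 0 →ₗ[ℤ] RegularPaths ℤ V 1 :=
  Finsupp.linearCombination ℤ fun i => (p (i.1 0)).pathSum (elemEdge ℤ)

theorem cone_elem (a : V) : cone p (elem ℤ ![a]) = (p a).pathSum (elemEdge ℤ) := by
  rw [elem_eq_single (fun k => k.elim0), cone, Finsupp.linearCombination_single, one_smul]
  rfl

/-- Stated for all allowed chains so that it can be proved edge by edge: the edge `a → c` yields the
loop `p a · (a → c) · (p c)⁻¹`, whose cycle is `e_{ac}` minus the cone of its boundary. The
existential records that the corrected chain is a cycle. -/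
theorem hurewicz_diagLift {x : RegularPaths ℤ V 1} (hx : x ∈ allowedPaths ℤ G 1) :
    ∃ z : cycles ℤ G 1, hurewicz G b ℤ (diagLift p x) = Submodule.Quotient.mk z ∧
      (z : RegularPaths ℤ V 1) = x - cone p (boundary ℤ V 0 x) := by
  induction hx using Submodule.span_induction with
  | zero => exact ⟨0, by simp, by simp⟩
  | add x y _ _ hx hy =>
    obtain ⟨z, hz, hzx⟩ := hx
    obtain ⟨z', hz', hzy⟩ := hy
    refine ⟨z + z', by rw [map_add, map_add, hz, hz']; rfl, ?_⟩
    rw [Submodule.coe_add, hzx, hzy, map_add, map_add]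
    abel
  | smul r x _ hx =>
    obtain ⟨z, hz, hzx⟩ := hx
    refine ⟨r • z, by rw [map_smul, map_zsmul, hz]; rfl, ?_⟩
    rw [Submodule.coe_smul, hzx, map_smul, map_smul, smul_sub]
  | mem x hx =>
    obtain ⟨i, hi, rfl⟩ := hx
    have h : EqOrAdj G (i 0) (i 1) := Or.inr (hi 0)
    refine ⟨(((p (i 0)).trans (Path.edge h)).trans (p (i 1)).symm).toLoop.cycle ℤ, ?_, ?_⟩
    · rw [elem_eq_elemEdge, diagLift_elemEdge, diagClass_edge p h]
      rfl
    · rw [elem_eq_elemEdge, boundary_elemEdge, map_sub, cone_elem, cone_elem]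
      change (((p (i 0)).trans (Path.edge h)).trans (p (i 1)).symm).pathSum (elemEdge ℤ) = _
      rw [Path.pathSum_trans, Path.pathSum_trans, Path.pathSum_symm, Path.pathSum_edge]
      abel

theorem hurewicz_hurewiczInv (x : PathHomology ℤ G 1) :
    hurewicz G b ℤ (hurewiczInv p x) = x := by
  obtain ⟨z, rfl⟩ := Submodule.Quotient.mk_surjective _ x
  obtain ⟨z', hz, hzz⟩ := hurewicz_diagLift p z.2.1.1
  -- On a cycle the cone correction vanishes.
  rw [show boundary ℤ V 0 (z : RegularPaths ℤ V 1) = 0 from z.2.2, map_zero, sub_zero] at hzz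
  obtain rfl : z' = z := Subtype.ext hzz
  exact hz

end Inverse

end DigraphHomotopy

theorem theorem4p20 {V : Type*} [Finite V] (G : Digraph V) (hG : ∀ v, ¬ G.Adj v v) (b : V)
    (hconn : DigraphHomotopy.Connected G) :
    Nonempty (Additive (Abelianization (DigraphHomotopy.FundamentalGroup G b)) ≃+
      DigraphHomotopy.PathHomology ℤ G 1) := by
  choose φ hs ht using hconn b
  -- Connectedness enters only through this choice of paths from `b`.
  let p : ∀ v, DigraphHomotopy.Path G b v := fun v => ⟨φ v, hs v, ht v⟩
  exact ⟨
    { DigraphHomotopy.hurewicz G b ℤ with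
      invFun := DigraphHomotopy.hurewiczInv p
      left_inv := DigraphHomotopy.hurewiczInv_hurewicz p
      right_inv := DigraphHomotopy.hurewicz_hurewiczInv p }⟩
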